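/- **Conventions.** Graphs are finite and may have loops and parallel edges; a loop counts twice in degrees. A signed graph is a graph $G$ with a signature $\sigma:E(G)\to\{1,-1\}$. Switching at a vertex changes the sign of all non-loop edges at it; signatures related by switchings are equivalent. $G$ is balanced if some equivalent signature has no negative edge, and unbalanced otherwise. A cycle is positive (negative) if the product of the signs of its edges is $1$ ($-1$). $\delta_G(X)$ is the set of edges of $G$ with exactly one end in $X$. A theta is a 2-connected graph of maximum degree $3$ with exactly two vertices of degree $3$. A block is a maximal connected subgraph without a cut vertex of its own; a leaf-block of $G'$ is a block that contains at most one cut vertex of $G'$. A generalized cycle is a cycle or a single vertex. Let $H$ be a subgraph of a signed graph $G'$ of maximum degree at most $3$. A generalized cycle $C\subseteq H$ is *good in $H$* if it is a single vertex of degree $0$ or $1$ in $G'$, or a positive cycle with at least two vertices of degree $2$ in $H$. It is *usable in $H$* if it is good in $H$, or is a negative cycle with at most one vertex whose degree in $H$ is not $2$. *Good in $G'$* is the case $H=G'$. A *fish* is a signed graph that is the union of a theta $T$ whose branches have lengths $2$, $2$, $3$ and a path $P$ of odd length at least $3$ that is internally disjoint from $T$ and whose ends are the two adjacent vertices of degree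 $2$ of $T$, such that $T$ is balanced and $T\cup P$ is unbalanced. Its *distinguished edge* is the unique edge that lies in no edge cut of size $2$ of the fish. **Cycle Selection Algorithm.** *Input:* a signed 3-edge-connected cubic graph $G$ with two vertex-disjoint negative cycles. *Output:* a list $\mathcal C=C_1,\dots,C_t$ of subgraphs, each declared to be positive, negative ordinary, negative special, or fish. *Pre-process step.* If $G$ has vertex-disjoint negative cycles $C_1,C_2$ with $V(C_1)\cup V(C_2)=V(G)$, declare both (for some such pair) negative special and return $C_1,C_2$. Otherwise let $C_1$ be a negative cycle such that $G-V(C_1)$ contains an unbalanced theta, declare it negative special, and start the recursion with $\mathcal C=C_1$. *Recursive step*, given $\mathcal C=C_1,\dots,C_{i-1}$. Let $G'=G-\bigcup_{j<i}V(C_j)$. 1. If $G'$ is empty, return $\mathcal C$. 2. Let $H$ be a leaf-block of $G'$, chosen so that $G'-V(H)$ contains an unbalanced theta if possible. 3. If $G'$ contains no unbalanced theta, let $C_i$ be usable in $H$, declare it negative ordinary if it is a negative cycle and positive otherwise, append it to $\mathcal C$ and recurse. 4. Otherwise, if $H$ is a negative cycle, declare $C_i=H$ negative ordinary, append it and recurse.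 5. Otherwise let $C_i$ be good in $H$, chosen so that $G'-V(C_i)$ contains an unbalanced theta if possible. 6. If $G'-V(C_i)$ contains an unbalanced theta, declare $C_i$ positive, append it and recurse. 7. Otherwise discard this $C_i$ and let $k$ be the number of negative ordinary cycles of even length in $\mathcal C$. 8. (a) If $G'$ is switching equivalent to a fish: if $k$ is odd, declare $C_i=G'$ fish; if $k$ is even, let $C_i$ be good in $G'$ and declare it positive. Append $C_i$ and recurse. (b) If not, let $D_0,D_1\subseteq G'$ be cycles such that: $D_1$ is negative and $D_0$ is good in $G'$; $G'-V(D_1)$ contains no unbalanced theta; $G'-V(D_0)$ and $G'-V(D_1)$ have the same negative cycles of even length; and either $D_1$ has at least two vertices of degree $2$ in $G'$, or it has at least one such vertex and $G'-V(D_1)$ has at most two negative cycles. Let $j$ be the number of negative cycles of even length in $G'-V(D_0)$. If $k+j$ is even, let $C_i=D_1$ and declare it negative special; otherwise let $C_i=D_0$ and declare it positive. Append $C_i$ and recurse. **Orientations and preflows.** An orientation of a signed graph directs each of the two half-edges of every edge either away from or towards its end, so that the two directions of a positive edge are one away and one towards its ends and the two directions of a negative edge are both away or both towards. For an abelian group $A$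 and $\phi:E\to A$, the boundary $\partial\phi(v)$ is the sum of $\phi$ over the half-edges directed away from $v$ minus the sum over those directed towards $v$. If all degrees are at most $3$, $\phi$ is a *preflow* when, for every vertex $v$, $\partial\phi(v)\ne0$ if and only if $\deg(v)\in\{1,2\}$. **Lemma.** Let $G$ be a signed 3-edge-connected cubic graph with two vertex-disjoint negative cycles, and let $\mathcal C=C_1,\dots,C_t$ be any list returned by the Cycle Selection Algorithm on input $G$. Let $G^*$ be any orientation of a signed graph obtained from $G$ by subdividing (once) exactly one edge of every negative special cycle and of every negative ordinary cycle of even length in $\mathcal C$, where the signs of the two halves of a subdivided edge multiply to the sign of that edge. Then there is a preflow $\phi:E(G^*)\to\mathbb Z_3$ such that $\phi(e)=0$ only if $e$ lies in (the subdivision of) a negative special cycle of $\mathcal C$, or in a positive cycle of $\mathcal C$, or is the distinguished edge of a fish of $\mathcal C$. -/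

import Mathlib

open scoped Graph

namespace CycleSelection

variable {α β : Type*}

/-! ### Multigraphs -/

/-- The degree of a vertex; a loop counts twice. -/
noncomputable def degree (G : Graph α β) (v : α) : ℕ :=
  (G.incidenceSet v).ncard + (G.loopSet v).ncard

/-- `y` can be reached from `x` along edges of `G`. -/
def Reach (G : Graph α β) (x y : α) : Prop := Relation.ReflTransGen G.Adj x y

def Connected (G : Graph α β) : Prop :=
  V(G).Nonempty ∧ ∀ x ∈ V(G), ∀ y ∈ V(G), Reach G x y

def EdgeConnected (k : ℕ) (G : Graph α β) : Prop :=
  ∀ F ⊆ E(G), F.ncard < k → Connected (G.deleteEdges F)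

def Cubic (G : Graph α β) : Prop := ∀ v ∈ V(G), degree G v = 3

/-- The edge cut `δ(X)`: the edges with one end in `X` and the other end outside `X`. -/
def edgeCut (G : Graph α β) (X : Set α) : Set β :=
  {e | ∃ x y, G.IsLink e x y ∧ x ∈ X ∧ y ∉ X}

/-- A vertex that separates two other vertices of the same component. -/
def IsCutVertex (G : Graph α β) (v : α) : Prop :=
  v ∈ V(G) ∧ ∃ x ∈ V(G), ∃ y ∈ V(G), x ≠ v ∧ y ≠ v ∧ Reach G x y ∧ ¬ Reach (G.deleteVerts {v}) x y

/-- A block: a maximal connected subgraph that has no cut vertex of its own. -/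
def IsBlock (G H : Graph α β) : Prop :=
  Maximal (fun K : Graph α β => K ≤ G ∧ Connected K ∧ ∀ v, ¬ IsCutVertex K v) H

/-- A leaf-block: a block that contains at most one cut vertex of the whole graph, that is, a
node of degree at most one of the block-cut tree. -/
def IsLeafBlock (G H : Graph α β) : Prop :=
  IsBlock G H ∧ {v ∈ V(H) | IsCutVertex G v}.Subsingleton

/-- A (finite) graph that is a cycle: connected with all degrees equal to two. -/
def IsCycle (C : Graph α β) : Prop := Connected C ∧ ∀ v ∈ V(C), degree C v = 2

/-- A (finite) graph that is a path of positive length with ends `x` and `y`. -/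
def IsPath (P : Graph α β) (x y : α) : Prop :=
  Connected P ∧ x ∈ V(P) ∧ y ∈ V(P) ∧ x ≠ y ∧ degree P x = 1 ∧ degree P y = 1 ∧
    ∀ v ∈ V(P), v ≠ x → v ≠ y → degree P v = 2

/-- The length of a cycle or of a path. -/
noncomputable def length (C : Graph α β) : ℕ := E(C).ncard

/-- A theta: a 2-connected subcubic graph with exactly two vertices of degree three. -/
def IsTheta (T : Graph α β) : Prop :=
  T.Loopless ∧ Connected T ∧ (∀ v, ¬ IsCutVertex T v) ∧ (∀ v ∈ V(T), degree T v ≤ 3) ∧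
    {v ∈ V(T) | degree T v = 3}.ncard = 2

/-! ### Signed graphs

A signed graph is a graph `G` with a signature `σ : β → ℤˣ`; only the values of `σ` on the edges
of `G` matter. -/

/-- `τ` arises from `σ` by switching at the vertices `x` with `s x = -1`. -/
def SwitchEquivalent (G : Graph α β) (σ τ : β → ℤˣ) : Prop :=
  ∃ s : α → ℤˣ, ∀ e x y, G.IsLink e x y → τ e = s x * σ e * s y

/-- Some equivalent signature has no negative edge. -/
def Balanced (σ : β → ℤˣ) (G : Graph α β) : Prop :=
  ∃ τ : β → ℤˣ, SwitchEquivalent G σ τ ∧ ∀ e ∈ E(G), τ e = 1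

/-- The sign of a subgraph: the product of the signs of its edges. -/
noncomputable def sign (σ : β → ℤˣ) (C : Graph α β) : ℤˣ := ∏ᶠ e ∈ E(C), σ e

def IsPositiveCycle (σ : β → ℤˣ) (C : Graph α β) : Prop := IsCycle C ∧ sign σ C = 1

def IsNegativeCycle (σ : β → ℤˣ) (C : Graph α β) : Prop := IsCycle C ∧ sign σ C = -1

def HasUnbalancedTheta (σ : β → ℤˣ) (G : Graph α β) : Prop :=
  ∃ T ≤ G, IsTheta T ∧ ¬ Balanced σ T

/-- A theta `H` with three internally disjoint branches of lengths two, two and three, together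
with a path `P` of odd length at least three that meets `H` in its ends only, the ends being two
adjacent vertices of degree two of `H`; `H` is balanced and the whole graph is not. -/
def IsFish (σ : β → ℤˣ) (G : Graph α β) : Prop :=
  ∃ H ≤ G, ∃ P ≤ G,
    (∃ p q, ∃ B₁ ≤ H, ∃ B₂ ≤ H, ∃ B₃ ≤ H,
      IsPath B₁ p q ∧ IsPath B₂ p q ∧ IsPath B₃ p q ∧
      length B₁ = 2 ∧ length B₂ = 2 ∧ length B₃ = 3 ∧
      V(B₁) ∩ V(B₂) = {p, q} ∧ V(B₁) ∩ V(B₃) = {p, q} ∧ V(B₂) ∩ V(B₃) = {p, q} ∧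
      V(H) = V(B₁) ∪ V(B₂) ∪ V(B₃) ∧ E(H) = E(B₁) ∪ E(B₂) ∪ E(B₃)) ∧
    (∃ x y, IsPath P x y ∧ Odd (length P) ∧ 3 ≤ length P ∧ V(P) ∩ V(H) = {x, y} ∧
      degree H x = 2 ∧ degree H y = 2 ∧ H.Adj x y) ∧
    V(G) = V(H) ∪ V(P) ∧ E(G) = E(H) ∪ E(P) ∧
    Balanced σ H ∧ ¬ Balanced σ G

/-- The distinguished edge of a fish: the edge that lies in no 2-edge cut of the fish. -/
def IsDistinguishedEdge (F : Graph α β) (e : β) : Prop :=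
  e ∈ E(F) ∧ ∀ X : Set α, (edgeCut F X).ncard = 2 → e ∉ edgeCut F X

/-! ### Good and usable generalized cycles

A generalized cycle is a cycle or a single vertex. It is selected inside a subgraph `H` (a
leaf-block, or the whole graph) of `G`: the vertices of degree two on a cycle are those of degree
two in `H`, whereas a single vertex has to have degree at most one in `G`. -/

def IsGoodIn (σ : β → ℤˣ) (G H C : Graph α β) : Prop :=
  C ≤ H ∧
    ((∃ v, C = Graph.noEdge {v} β ∧ degree G v ≤ 1) ∨
      (IsPositiveCycle σ C ∧ 2 ≤ {v ∈ V(C) | degree H v = 2}.ncard))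

def IsUsableIn (σ : β → ℤˣ) (G H C : Graph α β) : Prop :=
  IsGoodIn σ G H C ∨
    (C ≤ H ∧ IsNegativeCycle σ C ∧ {v ∈ V(C) | degree H v ≠ 2}.ncard ≤ 1)

/-- Good generalized cycles of a graph. -/
def IsGood (σ : β → ℤˣ) (G C : Graph α β) : Prop := IsGoodIn σ G G C

/-! ### The Cycle Selection Algorithm -/

inductive CycleType
  | positive
  | negativeOrdinary
  | negativeSpecial
  | fish

/-- The negative cycles of even length of `G`. -/
def evenNegativeCycles (σ : β → ℤˣ) (G : Graph α β) : Set (Graph α β) :=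
  {N | N ≤ G ∧ IsNegativeCycle σ N ∧ Even (length N)}

/-- The requirements on the pair of cycles `C₀, C₁` between which the algorithm decides according
to parity. -/
def IsParityPair (σ : β → ℤˣ) (G C₀ C₁ : Graph α β) : Prop :=
  (C₁ ≤ G ∧ IsNegativeCycle σ C₁) ∧ (IsCycle C₀ ∧ IsGood σ G C₀) ∧
  ¬ HasUnbalancedTheta σ (G.deleteVerts V(C₁)) ∧
  evenNegativeCycles σ (G.deleteVerts V(C₀)) = evenNegativeCycles σ (G.deleteVerts V(C₁)) ∧
  (2 ≤ {v ∈ V(C₁) | degree G v = 2}.ncard ∨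
    (1 ≤ {v ∈ V(C₁) | degree G v = 2}.ncard ∧
      {N | N ≤ G.deleteVerts V(C₁) ∧ IsNegativeCycle σ N}.ncard ≤ 2))

/-- The last step of a round, reached when `G` has an unbalanced theta but no choice of a good
cycle leaves one: `C` may be selected with type `t`, where `k` is the number of negative ordinary
cycles of even length selected so far. -/
inductive FinalStep (σ : β → ℤˣ) (G : Graph α β) (k : ℕ) : Graph α β → CycleType → Prop
  | fishOdd : (∃ τ, SwitchEquivalent G σ τ ∧ IsFish τ G) → Odd k →
      FinalStep σ G k G .fish
  | fishEven (C : Graph α β) : (∃ τ, SwitchEquivalent G σ τ ∧ IsFish τ G) → Even k →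
      IsGood σ G C → FinalStep σ G k C .positive
  | special (C₀ C₁ : Graph α β) : (¬ ∃ τ, SwitchEquivalent G σ τ ∧ IsFish τ G) →
      IsParityPair σ G C₀ C₁ →
      Even (k + (evenNegativeCycles σ (G.deleteVerts V(C₀))).ncard) →
      FinalStep σ G k C₁ .negativeSpecial
  | positive (C₀ C₁ : Graph α β) : (¬ ∃ τ, SwitchEquivalent G σ τ ∧ IsFish τ G) →
      IsParityPair σ G C₀ C₁ →
      Odd (k + (evenNegativeCycles σ (G.deleteVerts V(C₀))).ncard) →
      FinalStep σ G k C₀ .positive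

/-- A leaf-block whose removal leaves an unbalanced theta, if there is such a leaf-block, and any
leaf-block otherwise. -/
def IsChosenLeafBlock (σ : β → ℤˣ) (G H : Graph α β) : Prop :=
  IsLeafBlock G H ∧
    ((∃ H', IsLeafBlock G H' ∧ HasUnbalancedTheta σ (G.deleteVerts V(H'))) →
      HasUnbalancedTheta σ (G.deleteVerts V(H)))

/-- A good cycle in `H` whose removal from `G` leaves an unbalanced theta, if there is such a good
cycle, and any good cycle in `H` otherwise. -/
def IsChosenGoodCycle (σ : β → ℤˣ) (G H C : Graph α β) : Prop :=
  IsGoodIn σ G H C ∧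
    ((∃ C', IsGoodIn σ G H C' ∧ HasUnbalancedTheta σ (G.deleteVerts V(C'))) →
      HasUnbalancedTheta σ (G.deleteVerts V(C)))

/-- One round of the recursion on the remaining graph `G`: `C` may be selected with type `t`. -/
inductive Round (σ : β → ℤˣ) (G : Graph α β) (k : ℕ) : Graph α β → CycleType → Prop
  | usableNegative (H C : Graph α β) : IsChosenLeafBlock σ G H → ¬ HasUnbalancedTheta σ G →
      IsUsableIn σ G H C → IsNegativeCycle σ C → Round σ G k C .negativeOrdinary
  | usablePositive (H C : Graph α β) : IsChosenLeafBlock σ G H → ¬ HasUnbalancedTheta σ G →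
      IsUsableIn σ G H C → ¬ IsNegativeCycle σ C → Round σ G k C .positive
  | negativeBlock (H : Graph α β) : IsChosenLeafBlock σ G H → HasUnbalancedTheta σ G →
      IsNegativeCycle σ H → Round σ G k H .negativeOrdinary
  | good (H C : Graph α β) : IsChosenLeafBlock σ G H → HasUnbalancedTheta σ G →
      ¬ IsNegativeCycle σ H → IsChosenGoodCycle σ G H C →
      HasUnbalancedTheta σ (G.deleteVerts V(C)) → Round σ G k C .positive
  | final (H D C : Graph α β) (t : CycleType) : IsChosenLeafBlock σ G H →
      HasUnbalancedTheta σ G → ¬ IsNegativeCycle σ H → IsChosenGoodCycle σ G H D →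
      ¬ HasUnbalancedTheta σ (G.deleteVerts V(D)) → FinalStep σ G k C t → Round σ G k C t

/-- The graph that remains after deleting the vertices of all members of the list. -/
def remaining (G : Graph α β) (L : List (Graph α β × CycleType)) : Graph α β :=
  G.deleteVerts {v | ∃ p ∈ L, v ∈ V(p.1)}

open Classical in
/-- The number of negative ordinary cycles of even length in the list. -/
noncomputable def evenOrdinaryCount (L : List (Graph α β × CycleType)) : ℕ :=
  L.countP fun p => decide (p.2 = .negativeOrdinary ∧ Even (length p.1))

/-- Two vertex-disjoint negative cycles that together cover all the vertices. -/
def IsNegativePartition (σ : β → ℤˣ) (G C₁ C₂ : Graph α β) : Prop :=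
  C₁ ≤ G ∧ C₂ ≤ G ∧ IsNegativeCycle σ C₁ ∧ IsNegativeCycle σ C₂ ∧
    Disjoint V(C₁) V(C₂) ∧ V(C₁) ∪ V(C₂) = V(G)

/-- The lists that can occur during the recursive part of the algorithm on input `G`. -/
inductive Partial (σ : β → ℤˣ) (G : Graph α β) : List (Graph α β × CycleType) → Prop
  | start (C : Graph α β) : (¬ ∃ C₁ C₂, IsNegativePartition σ G C₁ C₂) →
      C ≤ G → IsNegativeCycle σ C → HasUnbalancedTheta σ (G.deleteVerts V(C)) →
      Partial σ G [(C, .negativeSpecial)]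
  | step (L : List (Graph α β × CycleType)) (C : Graph α β) (t : CycleType) : Partial σ G L →
      Round σ (remaining G L) (evenOrdinaryCount L) C t → Partial σ G (L ++ [(C, t)])

/-- `L` is a list that the algorithm can return on input `G`, for some choices it can make. -/
inductive Returned (σ : β → ℤˣ) (G : Graph α β) : List (Graph α β × CycleType) → Prop
  | preprocess (C₁ C₂ : Graph α β) : IsNegativePartition σ G C₁ C₂ →
      Returned σ G [(C₁, .negativeSpecial), (C₂, .negativeSpecial)]
  | recursion (L : List (Graph α β × CycleType)) : Partial σ G L → V(remaining G L) = ∅ →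
      Returned σ G L

/-! ### Subdivisions, orientations and preflows -/

/-- A labelling of the two ends of every edge of `G` by `false` and `true`, which gives names to
the two half-edges of every edge (loops included). -/
structure EndLabelling (G : Graph α β) where
  tip : β → Bool → α
  isLink : ∀ e ∈ E(G), G.IsLink e (tip e false) (tip e true)

/-- The graph obtained from `G` by subdividing every edge in `S` once. The vertex `inr e`
subdivides `e ∈ S`, whose two halves are the edges `inr (e, false)` and `inr (e, true)`; an edge
`e ∉ S` persists as `inl e`. -/
def subdivide (G : Graph α β) (ℓ : EndLabelling G) (S : Set β) :
    Graph (α ⊕ β) (β ⊕ β × Bool) where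
  vertexSet := Sum.inl '' V(G) ∪ Sum.inr '' (S ∩ E(G))
  IsLink
    | .inl e, u, v => e ∉ S ∧ ∃ x y, G.IsLink e x y ∧ u = .inl x ∧ v = .inl y
    | .inr (e, b), u, v => e ∈ S ∧ e ∈ E(G) ∧
        ((u = .inl (ℓ.tip e b) ∧ v = .inr e) ∨ (u = .inr e ∧ v = .inl (ℓ.tip e b)))
  isLink_symm := by
    rintro (e | ⟨e, b⟩) _ <;> refine ⟨fun u v h => ?_⟩
    · obtain ⟨h1, x, y, h2, h3, h4⟩ := h
      exact ⟨h1, y, x, h2.symm, h4, h3⟩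
    · obtain ⟨h1, h2, h3⟩ := h
      exact ⟨h1, h2, by tauto⟩
  eq_or_eq_of_isLink_of_isLink := by
    rintro (e | ⟨e, b⟩) u v w z h h'
    · obtain ⟨-, x, y, h2, rfl, rfl⟩ := h
      obtain ⟨-, x', y', h2', rfl, rfl⟩ := h'
      simpa using h2.left_eq_or_eq h2'
    · obtain ⟨-, -, h3⟩ := h
      obtain ⟨-, -, h3'⟩ := h'
      rcases h3 with ⟨rfl, rfl⟩ | ⟨rfl, rfl⟩ <;> rcases h3' with ⟨rfl, rfl⟩ | ⟨rfl, rfl⟩ <;> simp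
  left_mem_of_isLink := by
    rintro (e | ⟨e, b⟩) u v h
    · obtain ⟨-, x, y, h2, rfl, rfl⟩ := h
      exact Or.inl ⟨x, h2.left_mem, rfl⟩
    · obtain ⟨h1, h2, h3⟩ := h
      rcases h3 with ⟨rfl, rfl⟩ | ⟨rfl, rfl⟩
      · refine Or.inl ⟨_, ?_, rfl⟩
        cases b
        · exact (ℓ.isLink e h2).left_mem
        · exact (ℓ.isLink e h2).right_mem
      · exact Or.inr ⟨e, ⟨h1, h2⟩, rfl⟩

/-- The edge of the original graph of which an edge of a subdivision is (a half of). -/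
def parent : β ⊕ β × Bool → β := Sum.elim id Prod.fst

/-- `σ'` is a signature of the subdivided graph that comes from `σ`: undivided edges keep their
sign, and the signs of the two halves of a subdivided edge multiply to the sign of the edge. -/
def IsSubdividedSignature (G : Graph α β) (S : Set β) (σ : β → ℤˣ) (σ' : β ⊕ β × Bool → ℤˣ) :
    Prop :=
  ∀ e ∈ E(G), (e ∉ S → σ' (.inl e) = σ e) ∧
    (e ∈ S → σ' (.inr (e, false)) * σ' (.inr (e, true)) = σ e)

/-- `S` consists of exactly one edge of every negative special cycle and of every negative
ordinary cycle of even length in the list. -/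
def IsSubdivisionChoice (L : List (Graph α β × CycleType)) (S : Set β) : Prop :=
  let M := {C : Graph α β | (C, .negativeSpecial) ∈ L ∨
    ((C, .negativeOrdinary) ∈ L ∧ Even (length C))}
  (∀ C ∈ M, ∃! e, e ∈ S ∧ e ∈ E(C)) ∧ ∀ e ∈ S, ∃ C ∈ M, e ∈ E(C)

/-- An orientation of the signed graph `(G, σ)`: every half-edge is directed away from its end
(`1`) or towards it (`-1`). The two directions of a positive edge differ, those of a negative
edge agree. -/
structure Orientation (G : Graph α β) (σ : β → ℤˣ) extends EndLabelling G where
  dir : β → Bool → ℤˣ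
  dir_mul_dir : ∀ e ∈ E(G), dir e false * dir e true = - σ e

/-- The boundary of `f` at `v`: the sum over the half-edges directed away from `v` minus the sum
over those directed towards `v`. -/
noncomputable def boundary {A : Type*} [AddCommGroup A] {G : Graph α β} {σ : β → ℤˣ}
    (O : Orientation G σ) (f : β → A) (v : α) : A :=
  ∑ᶠ (h : β × Bool) (_ : h.1 ∈ E(G) ∧ O.tip h.1 h.2 = v), (O.dir h.1 h.2 : ℤ) • f h.1

def IsPreflow {A : Type*} [AddCommGroup A] {G : Graph α β} {σ : β → ℤˣ}
    (O : Orientation G σ) (f : β → A) : Prop :=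
  ∀ v ∈ V(G), boundary O f v ≠ 0 ↔ (degree G v = 1 ∨ degree G v = 2)

end CycleSelection

/-!
A preflow of the subdivision amounts to values in `ZMod 3` on the half-edges of `G` whose two values
on an edge are related by its sign exactly if the edge is not divided. Such values are found by
running the algorithm backwards: a preflow of `G' - V(C)` extends, with nonzero values, to the edges
of `G'` that attach `C`, and then has to be corrected on `C`.

Over `ZMod 3` the boundary map of an unbalanced connected graph is onto, which settles negative
special cycles. For a positive cycle the image of the boundary map is the orthogonal complement of a
function without zeros, so it suffices that two vertices of the cycle leave the sign of their
boundary open: a vertex of degree two does, and so does a vertex whose third edge leads to a part of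
the graph that can be negated separately. A negative ordinary cycle has odd length once it is
subdivided, so negating all its signs makes it balanced, and a potential of the result provides
values that vanish nowhere. The same trick, applied off the distinguished edge, serves for a fish.
-/

namespace CycleSelection

variable {α β : Type*}

/-! ### Half-edges -/

/-- The vertices `t e false` and `t e true` are the two ends of every edge `e` of `K`. A half-edge
is a pair `(e, b)`, and its end is `t e b`. -/
def IsEndLabelling (K : Graph α β) (t : β → Bool → α) : Prop :=
  ∀ e ∈ E(K), K.IsLink e (t e false) (t e true)

namespace IsEndLabelling

variable {G K : Graph α β} {t : β → Bool → α} {e : β}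

lemma mono (ht : IsEndLabelling G t) (hK : K ≤ G) : IsEndLabelling K t :=
  fun e he => (Graph.IsSubgraph.isLink_iff hK he).2 (ht e (hK.edgeSet_mono he))

lemma isLink (ht : IsEndLabelling K t) (he : e ∈ E(K)) (b : Bool) :
    K.IsLink e (t e b) (t e !b) := by
  cases b
  exacts [ht e he, (ht e he).symm]

lemma mem (ht : IsEndLabelling K t) (he : e ∈ E(K)) (b : Bool) : t e b ∈ V(K) :=
  (ht.isLink he b).left_mem

lemma exists_of_isLink (ht : IsEndLabelling K t) {x y : α} (hl : K.IsLink e x y) :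
    ∃ b, t e b = x ∧ t e (!b) = y := by
  rcases hl.eq_and_eq_or_eq_and_eq (ht e hl.edge_mem) with ⟨rfl, rfl⟩ | ⟨rfl, rfl⟩
  exacts [⟨false, rfl, rfl⟩, ⟨true, rfl, rfl⟩]

end IsEndLabelling

/-- The half-edges with end `v` of the edges in `F`. -/
def halfEdgesAt (t : β → Bool → α) (F : Set β) (v : α) : Set (β × Bool) :=
  {h | h.1 ∈ F ∧ t h.1 h.2 = v}

/-- The sum of `c` over the half-edges with end `v` of the edges in `F`. -/
noncomputable def halfEdgeSum {A : Type*} [AddCommMonoid A] (t : β → Bool → α) (F : Set β)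
    (c : β × Bool → A) (v : α) : A :=
  ∑ᶠ h ∈ halfEdgesAt t F v, c h

section HalfEdges

variable {A : Type*} {t : β → Bool → α} {F F' : Set β} {v : α}

lemma halfEdgesAt_union : halfEdgesAt t (F ∪ F') v = halfEdgesAt t F v ∪ halfEdgesAt t F' v := by
  ext h
  exact or_and_right

lemma disjoint_halfEdgesAt (h : Disjoint F F') :
    Disjoint (halfEdgesAt t F v) (halfEdgesAt t F' v) :=
  Set.disjoint_left.2 fun _ h₁ h₂ => Set.disjoint_left.1 h h₁.1 h₂.1

lemma halfEdgeSum_congr [AddCommMonoid A] {c c' : β × Bool → A}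
    (h : ∀ p ∈ halfEdgesAt t F v, c p = c' p) : halfEdgeSum t F c v = halfEdgeSum t F c' v :=
  finsum_mem_congr rfl h

lemma halfEdgeSum_of_halfEdgesAt_eq_empty [AddCommMonoid A] (h : halfEdgesAt t F v = ∅)
    (c : β × Bool → A) : halfEdgeSum t F c v = 0 := by
  rw [halfEdgeSum, h, finsum_mem_empty]

variable [Finite β]

lemma halfEdgeSum_union [AddCommMonoid A] (h : Disjoint F F') (c : β × Bool → A) :
    halfEdgeSum t (F ∪ F') c v = halfEdgeSum t F c v + halfEdgeSum t F' c v := by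
  rw [halfEdgeSum, halfEdgesAt_union,
    finsum_mem_union (disjoint_halfEdgesAt h) (Set.toFinite _) (Set.toFinite _)]
  rfl

lemma halfEdgeSum_add [AddCommMonoid A] (c c' : β × Bool → A) :
    halfEdgeSum t F (c + c') v = halfEdgeSum t F c v + halfEdgeSum t F c' v :=
  finsum_mem_add_distrib (Set.toFinite _)

lemma halfEdgeSum_const_mul [NonUnitalNonAssocSemiring A] (a : A) (c : β × Bool → A) :
    halfEdgeSum t F (fun h => a * c h) v = a * halfEdgeSum t F c v :=
  (mul_finsum_mem' c a (Set.toFinite _)).symm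

@[to_additive]
lemma finprod_mem_eq_pow_ncard {ι M : Type*} [CommMonoid M] {s : Set ι} (hs : s.Finite) {f : ι → M}
    {a : M} (h : ∀ i ∈ s, f i = a) : ∏ᶠ i ∈ s, f i = a ^ s.ncard := by
  rw [finprod_mem_eq_finite_toFinset_prod f hs, Set.ncard_eq_toFinset_card s hs]
  exact Finset.prod_eq_pow_card fun i hi => h i (hs.mem_toFinset.1 hi)

lemma halfEdgeSum_eq_nsmul [AddCommMonoid A] {c : β × Bool → A} {a : A}
    (h : ∀ p ∈ halfEdgesAt t F v, c p = a) :
    halfEdgeSum t F c v = (halfEdgesAt t F v).ncard • a :=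
  finsum_mem_eq_nsmul_ncard (Set.toFinite _) h

lemma ncard_halfEdgesAt : (halfEdgesAt t F v).ncard =
    {e ∈ F | t e false = v}.ncard + {e ∈ F | t e true = v}.ncard := by
  have hsplit : halfEdgesAt t F v =
      (·, false) '' {e ∈ F | t e false = v} ∪ (·, true) '' {e ∈ F | t e true = v} := by
    ext ⟨e, b⟩
    cases b <;> simp [halfEdgesAt]
  rw [hsplit, Set.ncard_union_eq, Set.ncard_image_of_injective, Set.ncard_image_of_injective]
  · exact Prod.mk_left_injective _
  · exact Prod.mk_left_injective _
  · rw [Set.disjoint_left]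
    rintro _ ⟨e, -, rfl⟩ ⟨e', -, h⟩
    exact Bool.noConfusion (congrArg Prod.snd h)

@[to_additive]
lemma finprod_finprod_halfEdgesAt [Finite α] {M : Type*} [CommMonoid M] (t : β → Bool → α)
    (F : Set β) (g : β × Bool → M) :
    ∏ᶠ v, ∏ᶠ h ∈ halfEdgesAt t F v, g h = ∏ᶠ e ∈ F, g (e, false) * g (e, true) := by
  have hunion : ⋃ v, halfEdgesAt t F v = ⋃ e ∈ F, {(e, false), (e, true)} := by
    ext ⟨e, b⟩
    cases b <;> simp [halfEdgesAt]
  rw [← finprod_mem_iUnion _ fun _ => Set.toFinite _, hunion,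
    finprod_mem_biUnion _ (Set.toFinite _) fun _ _ => Set.toFinite _]
  · exact finprod_mem_congr rfl fun e _ => finprod_mem_pair (by simp)
  · intro e _ e' _ hne
    simp [Function.onFun, hne.symm]
  · exact fun v w hne => Set.disjoint_left.2 fun h hv hw => hne (hv.2.symm.trans hw.2)

lemma finsum_mul_halfEdgeSum [Finite α] [CommSemiring A] (t : β → Bool → α) (F : Set β)
    (c : β × Bool → A) (l : α → A) :
    ∑ᶠ v, l v * halfEdgeSum t F c v =
      ∑ᶠ e ∈ F, (l (t e false) * c (e, false) + l (t e true) * c (e, true)) := by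
  rw [← finsum_finsum_halfEdgesAt t F fun h => l (t h.1 h.2) * c h]
  refine finsum_congr fun v => ?_
  rw [← halfEdgeSum_const_mul]
  exact halfEdgeSum_congr fun h hh => by rw [hh.2]

end HalfEdges

section Degree

variable {G K : Graph α β} {t : β → Bool → α} {v : α}

lemma halfEdgesAt_eq_empty_of_notMem (ht : IsEndLabelling K t) (hv : v ∉ V(K)) :
    halfEdgesAt t E(K) v = ∅ :=
  Set.eq_empty_of_forall_notMem fun _ hh => hv (hh.2 ▸ ht.mem hh.1 _)

lemma halfEdgeSum_of_notMem {A : Type*} [AddCommMonoid A] (ht : IsEndLabelling K t) (hv : v ∉ V(K))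
    (c : β × Bool → A) : halfEdgeSum t E(K) c v = 0 :=
  halfEdgeSum_of_halfEdgesAt_eq_empty (halfEdgesAt_eq_empty_of_notMem ht hv) c

variable [Finite β]

lemma degree_eq_ncard_halfEdgesAt (ht : IsEndLabelling K t) (v : α) :
    degree K v = (halfEdgesAt t E(K) v).ncard := by
  rw [ncard_halfEdgesAt, ← Set.ncard_union_add_ncard_inter, degree]
  congr 2 <;> ext e <;> by_cases he : e ∈ E(K)
  · have hinc : K.Inc e v ↔ v = t e false ∨ v = t e true :=
      ⟨fun h => h.eq_or_eq_of_isLink (ht e he), by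
        rintro (rfl | rfl)
        exacts [(ht.isLink he false).inc_left, (ht.isLink he true).inc_left]⟩
    simp [he, hinc, eq_comm]
  · simp [he]
  · simp [he, ← Graph.isLink_self_iff, Graph.IsLink.isLink_iff (ht e he), and_comm]
  · simp [he, ← Graph.isLink_self_iff]

lemma degree_eq_zero_of_notMem (ht : IsEndLabelling K t) (hv : v ∉ V(K)) : degree K v = 0 := by
  rw [degree_eq_ncard_halfEdgesAt ht, halfEdgesAt_eq_empty_of_notMem ht hv, Set.ncard_empty]

lemma degree_add_ncard_halfEdgesAt_sdiff (ht : IsEndLabelling G t) (h : K ≤ G) (v : α) :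
    degree K v + (halfEdgesAt t (E(G) \ E(K)) v).ncard = degree G v := by
  rw [degree_eq_ncard_halfEdgesAt ht, degree_eq_ncard_halfEdgesAt (ht.mono h),
    ← Set.ncard_union_eq (disjoint_halfEdgesAt Set.disjoint_sdiff_right), ← halfEdgesAt_union,
    Set.union_sdiff_cancel h.edgeSet_mono]

lemma degree_mono (ht : IsEndLabelling G t) (h : K ≤ G) (v : α) : degree K v ≤ degree G v :=
  degree_add_ncard_halfEdgesAt_sdiff ht h v ▸ Nat.le_add_right _ _

lemma halfEdgesAt_sdiff_eq_empty (ht : IsEndLabelling G t) (h : K ≤ G)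
    (hd : degree G v ≤ degree K v) : halfEdgesAt t (E(G) \ E(K)) v = ∅ := by
  have := degree_add_ncard_halfEdgesAt_sdiff ht h v
  exact (Set.ncard_eq_zero (Set.toFinite _)).1 (by lia)

lemma finsum_degree [Finite α] (ht : IsEndLabelling K t) : ∑ᶠ v, degree K v = 2 * E(K).ncard := by
  have h := finsum_finsum_halfEdgesAt t E(K) fun _ => (1 : ℕ)
  simp only [finsum_mem_eq_nsmul_ncard (Set.toFinite _) fun _ _ => rfl, smul_eq_mul, mul_one,
    ← degree_eq_ncard_halfEdgesAt ht, mul_comm _ (1 + 1)] at h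
  exact h

end Degree

/-! ### Potentials -/

/-- A sign as an element of `ZMod 3`. -/
def sg : ℤˣ →* ZMod 3 :=
  (Int.castRingHom (ZMod 3) : ℤ →* ZMod 3).comp (Units.coeHom ℤ)

lemma sg_neg : ∀ u : ℤˣ, sg (-u) = -sg u := by decide

lemma sg_ne_zero : ∀ u : ℤˣ, sg u ≠ 0 := by decide

lemma sg_mul_self : ∀ u : ℤˣ, sg u * sg u = 1 := by decide

lemma sg_injective : Function.Injective sg := by
  unfold Function.Injective
  decide

lemma exists_sg_eq : ∀ {z : ZMod 3}, z ≠ 0 → ∃ u, sg u = z := by decide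

section Connectivity

variable {G K : Graph α β} {t : β → Bool → α}

lemma Connected.eq_of_forall_isLink {γ : Type*} {f : α → γ} (hK : Connected K)
    (hf : ∀ e x y, K.IsLink e x y → f x = f y) {x y : α} (hx : x ∈ V(K)) (hy : y ∈ V(K)) :
    f x = f y := by
  have hxy := hK.2 x hx y hy
  induction hxy with
  | refl => rfl
  | tail _ hadj ih =>
    obtain ⟨e, he⟩ := hadj
    exact (ih he.left_mem).trans (hf e _ _ he)

/-- The edges in `F` with exactly one end in `X`. -/
def crossingEdges (t : β → Bool → α) (F : Set β) (X : Set α) : Set β :=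
  {e ∈ F | ¬ (t e false ∈ X ↔ t e true ∈ X)}

lemma Connected.crossingEdges_nonempty (hK : Connected K) (ht : IsEndLabelling K t) {X : Set α}
    {x y : α} (hx : x ∈ V(K)) (hy : y ∈ V(K)) (hxX : x ∈ X) (hyX : y ∉ X) :
    (crossingEdges t E(K) X).Nonempty := by
  by_contra! h
  refine hyX ((hK.eq_of_forall_isLink (f := (· ∈ X)) (fun e u v he => ?_) hx hy).mp hxX)
  obtain ⟨b, rfl, rfl⟩ := ht.exists_of_isLink he
  have hcross : t e false ∈ X ↔ t e true ∈ X := by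
    by_contra hc
    exact h.subset ⟨he.edge_mem, hc⟩
  cases b
  exacts [propext hcross, propext hcross.symm]

lemma connected_of_forall_crossingEdges (ht : IsEndLabelling K t) (hne : V(K).Nonempty)
    (h : ∀ X : Set α, ∀ x ∈ V(K), ∀ y ∈ V(K), x ∈ X → y ∉ X → (crossingEdges t E(K) X).Nonempty) :
    Connected K := by
  refine ⟨hne, fun x hx y hy => ?_⟩
  by_contra hxy
  obtain ⟨e, he, hcross⟩ := h {z | Reach K x z} x hx y hy .refl hxy
  exact hcross ⟨fun h => h.tail ⟨e, ht e he⟩, fun h => h.tail ⟨e, (ht e he).symm⟩⟩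

variable [Finite α] [Finite β]

lemma finprod_mul_ends (t : β → Bool → α) (F : Set β) (s : α → ℤˣ) :
    ∏ᶠ e ∈ F, s (t e false) * s (t e true) = ∏ᶠ v, s v ^ (halfEdgesAt t F v).ncard := by
  rw [← finprod_finprod_halfEdgesAt t F fun h => s (t h.1 h.2)]
  exact finprod_congr fun v => finprod_mem_eq_pow_ncard (Set.toFinite _) fun h hh => by rw [hh.2]

lemma even_ncard_crossingEdges {F : Set β} {X : Set α}
    (h : ∀ v ∈ X, Even (halfEdgesAt t F v).ncard) : Even (crossingEdges t F X).ncard := by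
  classical
  let s : α → ℤˣ := fun v => if v ∈ X then -1 else 1
  have hprod : ∏ᶠ e ∈ F, s (t e false) * s (t e true) = (-1) ^ (crossingEdges t F X).ncard := by
    rw [← finprod_mem_eq_pow_ncard (Set.toFinite _) fun _ _ => rfl]
    refine finprod_congr fun e => ?_
    by_cases he : e ∈ F <;> by_cases h₀ : t e false ∈ X <;> by_cases h₁ : t e true ∈ X <;>
      simp [s, crossingEdges, he, h₀, h₁]
  have hone : ∏ᶠ v, s v ^ (halfEdgesAt t F v).ncard = 1 :=
    finprod_eq_one_of_forall_eq_one fun v => by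
      by_cases hv : v ∈ X
      · obtain ⟨k, hk⟩ := h v hv
        rw [hk, pow_add, Int.units_mul_self]
      · simp [s, hv]
  rw [finprod_mul_ends, hone] at hprod
  exact (neg_one_pow_eq_one_iff_even (by decide)).1 hprod.symm

lemma ncard_edgeSet_lt (ht : IsEndLabelling K t) (h : ∀ v ∈ V(K), degree K v ≤ 2) {x : α}
    (hx : x ∈ V(K)) (hdx : degree K x < 2) : E(K).ncard < V(K).ncard := by
  classical
  have := Fintype.ofFinite α
  have hlt : ∑ v, degree K v < ∑ v, if v ∈ V(K) then 2 else 0 := by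
    refine Finset.sum_lt_sum (fun v _ => ?_) ⟨x, Finset.mem_univ x, by rwa [if_pos hx]⟩
    split_ifs with hv
    exacts [h v hv, (degree_eq_zero_of_notMem ht hv).le]
  have hcard : V(K).ncard = (Finset.univ.filter (· ∈ V(K))).card := by
    rw [← Set.ncard_coe_finset]
    simp
  rw [← finsum_eq_sum_of_fintype, finsum_degree ht, ← Finset.sum_filter, Finset.sum_const,
    ← hcard, smul_eq_mul] at hlt
  lia

end Connectivity

section Potential

variable {G K : Graph α β} {t : β → Bool → α} {σ : β → ℤˣ} {s s' : α → ℤˣ}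

/-- Switching at the vertices `x` with `s x = -1` makes every edge of `K` positive. -/
def IsPotential (σ : β → ℤˣ) (K : Graph α β) (s : α → ℤˣ) : Prop :=
  ∀ e x y, K.IsLink e x y → s x * s y = σ e

lemma isPotential_iff (ht : IsEndLabelling K t) :
    IsPotential σ K s ↔ ∀ e ∈ E(K), s (t e false) * s (t e true) = σ e := by
  refine ⟨fun hs e he => hs e _ _ (ht e he), fun h e x y he => ?_⟩
  obtain ⟨_ | _, rfl, rfl⟩ := ht.exists_of_isLink he
  exacts [h e he.edge_mem, (mul_comm _ _).trans (h e he.edge_mem)]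

lemma SwitchEquivalent.symm {τ : β → ℤˣ} (h : SwitchEquivalent G σ τ) :
    SwitchEquivalent G τ σ := by
  obtain ⟨u, hu⟩ := h
  refine ⟨u, fun e x y he => ?_⟩
  calc σ e = u x * u x * (u y * u y) * σ e := by simp only [Int.units_mul_self, one_mul]
    _ = u x * τ e * u y := by rw [hu e x y he]; ac_rfl

lemma balanced_iff_exists_isPotential : Balanced σ K ↔ ∃ s, IsPotential σ K s := by
  constructor
  · rintro ⟨τ, h, hτ⟩
    obtain ⟨s, hs⟩ := h.symm
    refine ⟨s, fun e x y he => ?_⟩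
    rw [hs e x y he, hτ e he.edge_mem, mul_one]
  · rintro ⟨s, hs⟩
    refine ⟨1, ⟨s, fun e x y he => ?_⟩, fun _ _ => rfl⟩
    rw [mul_right_comm, hs e x y he, Int.units_mul_self, Pi.one_apply]

lemma SwitchEquivalent.balanced {τ : β → ℤˣ} (h : SwitchEquivalent G σ τ) (hK : K ≤ G)
    (hb : Balanced σ K) : Balanced τ K := by
  obtain ⟨u, hu⟩ := h
  obtain ⟨s, hs⟩ := balanced_iff_exists_isPotential.1 hb
  refine balanced_iff_exists_isPotential.2 ⟨fun v => u v * s v, fun e x y he => ?_⟩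
  calc u x * s x * (u y * s y) = u x * (s x * s y) * u y := by ac_rfl
    _ = τ e := by rw [hs e x y he, hu e x y (he.mono hK)]

namespace IsPotential

lemma mono (hs : IsPotential σ G s) (hK : K ≤ G) : IsPotential σ K s :=
  fun e x y he => hs e x y (he.mono hK)

lemma apply_mul_apply (hs : IsPotential σ K s) (hs' : IsPotential σ K s') (hK : Connected K)
    {x y : α} (hx : x ∈ V(K)) (hy : y ∈ V(K)) : s x * s' x = s y * s' y := by
  refine hK.eq_of_forall_isLink (f := fun v => s v * s' v) (fun e u v he => ?_) hx hy
  calc s u * s' u = s u * s' u * (s v * s v * (s' v * s' v)) := by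
        simp only [Int.units_mul_self, mul_one]
    _ = s u * s v * (s' u * s' v) * (s v * s' v) := by ac_rfl
    _ = s v * s' v := by rw [hs e u v he, hs' e u v he, Int.units_mul_self, one_mul]

variable [Finite α] [Finite β]

lemma sign_eq (hs : IsPotential σ K s) (ht : IsEndLabelling K t) :
    sign σ K = ∏ᶠ v, s v ^ degree K v := by
  simp only [degree_eq_ncard_halfEdgesAt ht, ← finprod_mul_ends]
  exact finprod_mem_congr rfl fun e he => (hs e _ _ (ht e he)).symm

lemma sign_eq_one (hs : IsPotential σ K s) (hK : IsCycle K) (ht : IsEndLabelling K t) :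
    sign σ K = 1 := by
  rw [hs.sign_eq ht]
  refine finprod_eq_one_of_forall_eq_one fun v => ?_
  by_cases hv : v ∈ V(K)
  · rw [hK.2 v hv, sq, Int.units_mul_self]
  · rw [degree_eq_zero_of_notMem ht hv, pow_zero]

lemma sign_eq_mul (hs : IsPotential σ K s) {x y : α} (hK : IsPath K x y)
    (ht : IsEndLabelling K t) : sign σ K = s x * s y := by
  classical
  obtain ⟨-, -, -, hxy, hdx, hdy, hd⟩ := hK
  have hsub : (Function.mulSupport fun v => s v ^ degree K v) ⊆ ({x, y} : Finset α) := by
    intro v hv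
    by_contra hne
    simp only [Finset.coe_insert, Finset.coe_singleton, Set.mem_insert_iff,
      Set.mem_singleton_iff, not_or] at hne
    refine hv ?_
    beta_reduce
    by_cases hvK : v ∈ V(K)
    · rw [hd v hvK hne.1 hne.2, sq, Int.units_mul_self]
    · rw [degree_eq_zero_of_notMem ht hvK, pow_zero]
  rw [hs.sign_eq ht, finprod_eq_prod_of_mulSupport_subset _ hsub, Finset.prod_pair hxy, hdx, hdy,
    pow_one, pow_one]

end IsPotential

end Potential

/-! ### Boundaries on cycles and paths -/

/-- The failure of the relation between the values of `c` on the two halves of `e` that a boundary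
preflow value on an undivided edge satisfies: the values are opposite if `e` is positive and equal
if `e` is negative. -/
def edgeDefect (σ : β → ℤˣ) (c : β × Bool → ZMod 3) (e : β) : ZMod 3 :=
  c (e, true) + sg (σ e) * c (e, false)

section Boundary

variable {K : Graph α β} {t : β → Bool → α} {σ : β → ℤˣ}

lemma edgeDefect_add (c c' : β × Bool → ZMod 3) (e : β) :
    edgeDefect σ (c + c') e = edgeDefect σ c e + edgeDefect σ c' e := by
  simp only [edgeDefect, Pi.add_apply]
  ring

lemma edgeDefect_const_mul (a : ZMod 3) (c : β × Bool → ZMod 3) (e : β) :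
    edgeDefect σ (fun h => a * c h) e = a * edgeDefect σ c e := by
  simp only [edgeDefect]
  ring

lemma mem_of_forall_finsum_mul_eq_zero {k ι : Type*} [Field k] [Finite ι]
    {p : Submodule k (ι → k)} {D : ι → k}
    (h : ∀ l : ι → k, (∀ x ∈ p, ∑ᶠ i, l i * x i = 0) → ∑ᶠ i, l i * D i = 0) : D ∈ p := by
  classical
  have := Fintype.ofFinite ι
  by_contra hD
  obtain ⟨f, hf, hp⟩ := p.exists_le_ker_of_notMem hD
  have hf_eq (x : ι → k) : f x = ∑ᶠ i, f (Pi.single i 1) * x i := by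
    rw [f.pi_apply_eq_sum_univ, finsum_eq_sum_of_fintype]
    refine Finset.sum_congr rfl fun i _ => ?_
    rw [smul_eq_mul, mul_comm]
    congr 2
    ext j
    simp [Pi.single_apply, eq_comm]
  exact hf (hf_eq D ▸ h _ fun x hx => hf_eq x ▸ hp hx)

lemma exists_isPotential_of_linear_relation (hK : Connected K) {l : α → ZMod 3}
    (hl : ∀ e x y, K.IsLink e x y → l x = sg (σ e) * l y) {w : α} (hw : w ∈ V(K)) (hlw : l w ≠ 0) :
    ∃ s, IsPotential σ K s ∧ ∀ v ∈ V(K), sg (s v) = l v := by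
  have hzero : ∀ v ∈ V(K), l v ≠ 0 := fun v hv =>
    (hK.eq_of_forall_isLink (f := fun v => l v ≠ 0) (fun e x y he => by
      simp [hl e x y he, sg_ne_zero]) hw hv).mp hlw
  choose! s hs using fun v hv => exists_sg_eq (hzero v hv)
  refine ⟨s, fun e x y he => sg_injective ?_, hs⟩
  rw [map_mul, hs x he.left_mem, hl e x y he, ← hs y he.right_mem, mul_assoc, sg_mul_self, mul_one]

variable [Finite β]

/-- The functions that agree on `V(K)` with the boundary of an assignment of values to the
half-edges of `K` that satisfies the relation of an undivided edge on every edge. -/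
def boundarySpace (σ : β → ℤˣ) (t : β → Bool → α) (K : Graph α β) :
    Submodule (ZMod 3) (α → ZMod 3) where
  carrier := {D | ∃ c, (∀ e, edgeDefect σ c e = 0) ∧ ∀ v ∈ V(K), halfEdgeSum t E(K) c v = D v}
  zero_mem' := ⟨0, by simp [edgeDefect], by simp [halfEdgeSum]⟩
  add_mem' := by
    rintro D D' ⟨c, hc, hD⟩ ⟨c', hc', hD'⟩
    refine ⟨c + c', fun e => by rw [edgeDefect_add, hc, hc', add_zero], fun v hv => ?_⟩
    rw [halfEdgeSum_add, hD v hv, hD' v hv, Pi.add_apply]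
  smul_mem' := by
    rintro a D ⟨c, hc, hD⟩
    refine ⟨fun h => a * c h, fun e => by rw [edgeDefect_const_mul, hc, mul_zero],
      fun v hv => ?_⟩
    rw [halfEdgeSum_const_mul, hD v hv, Pi.smul_apply, smul_eq_mul]

lemma apply_eq_of_forall_mem_boundarySpace [Finite α] (ht : IsEndLabelling K t) {l : α → ZMod 3}
    (hl : ∀ D ∈ boundarySpace σ t K, ∑ᶠ v, l v * D v = 0) :
    (∀ v ∉ V(K), l v = 0) ∧ ∀ e x y, K.IsLink e x y → l x = sg (σ e) * l y := by
  classical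
  constructor
  · intro v hv
    have h := hl (Pi.single v 1) ⟨0, by simp [edgeDefect], fun w hw => ?_⟩
    · rwa [finsum_eq_single _ v fun w hw => by rw [Pi.single_eq_of_ne hw, mul_zero],
        Pi.single_eq_same, mul_one] at h
    · rw [Pi.single_eq_of_ne (ne_of_mem_of_not_mem hw hv)]
      exact finsum_mem_zero _
  · intro e x y he
    obtain ⟨b, rfl, rfl⟩ := ht.exists_of_isLink he
    let c : β × Bool → ZMod 3 := Function.update (Pi.single (e, b) 1) (e, !b) (-sg (σ e))
    have hc : ∀ e', edgeDefect σ c e' = 0 := fun e' => by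
      rcases eq_or_ne e' e with rfl | hne
      · cases b <;> simp [edgeDefect, c, sg_mul_self]
      · simp [edgeDefect, c, hne]
    have h := hl (halfEdgeSum t E(K) c) ⟨c, hc, fun _ _ => rfl⟩
    rw [finsum_mul_halfEdgeSum, finsum_eq_single _ e fun e' hne => by simp [c, hne],
      finsum_eq_if, if_pos he.edge_mem] at h
    cases b <;> simp [c] at h ⊢ <;> linear_combination h

variable [Finite α]

theorem mem_boundarySpace (hK : Connected K) (ht : IsEndLabelling K t) {D : α → ZMod 3}
    (hD : ∀ s, IsPotential σ K s → ∑ᶠ v ∈ V(K), sg (s v) * D v = 0) :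
    D ∈ boundarySpace σ t K := by
  refine mem_of_forall_finsum_mul_eq_zero fun l hl => ?_
  obtain ⟨hout, hedge⟩ := apply_eq_of_forall_mem_boundarySpace ht hl
  by_cases hne : ∃ v ∈ V(K), l v ≠ 0
  · obtain ⟨w, hw, hlw⟩ := hne
    obtain ⟨s, hs, hsl⟩ := exists_isPotential_of_linear_relation hK hedge hw hlw
    rw [← hD s hs]
    refine finsum_congr fun v => ?_
    by_cases hv : v ∈ V(K)
    · simp [hv, hsl]
    · simp [hv, hout]
  · push Not at hne
    refine finsum_eq_zero_of_forall_eq_zero fun v => ?_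
    by_cases hv : v ∈ V(K)
    exacts [by rw [hne v hv, zero_mul], by rw [hout v hv, zero_mul]]

lemma boundarySpace_eq_top (hK : Connected K) (ht : IsEndLabelling K t) (hσ : ¬ Balanced σ K) :
    boundarySpace σ t K = ⊤ :=
  eq_top_iff.2 fun _ _ => mem_boundarySpace hK ht fun s hs =>
    (hσ (balanced_iff_exists_isPotential.2 ⟨s, hs⟩)).elim

lemma exists_add_sg_mul_eq_zero : ∀ {p q : ZMod 3}, p ≠ 0 → q ≠ 0 → ∀ r,
    ∃ a b, r + sg a * p + sg b * q = 0 := by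
  decide

theorem exists_add_single_mem_boundarySpace [DecidableEq α] (hK : Connected K)
    (ht : IsEndLabelling K t) (D : α → ZMod 3) {x y : α} (hx : x ∈ V(K)) (hy : y ∈ V(K))
    {p q : ZMod 3} (hp : p ≠ 0) (hq : q ≠ 0) :
    ∃ a b, D + Pi.single x (sg a * p) + Pi.single y (sg b * q) ∈ boundarySpace σ t K := by
  by_cases hbal : ∃ s, IsPotential σ K s
  · obtain ⟨s, hs⟩ := hbal
    obtain ⟨a, b, hab⟩ := exists_add_sg_mul_eq_zero (mul_ne_zero (sg_ne_zero (s x)) hp)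
      (mul_ne_zero (sg_ne_zero (s y)) hq) (∑ᶠ v ∈ V(K), sg (s v) * D v)
    have hsingle {w : α} (hw : w ∈ V(K)) (r : ZMod 3) :
        ∑ᶠ v ∈ V(K), sg (s v) * (Pi.single w r : α → ZMod 3) v = sg (s w) * r := by
      rw [finsum_eq_single _ w fun v hv => by simp [hv],
        finsum_eq_single _ hw fun h hne => (hne rfl).elim, Pi.single_eq_same]
    refine ⟨a, b, mem_boundarySpace hK ht fun s' hs' => ?_⟩
    -- The potentials of `K` agree up to a global sign, so one linear condition has to be met.
    have hs'_eq : ∀ v ∈ V(K), sg (s' v) = sg (s x * s' x) * sg (s v) := fun v hv => by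
      rw [hs.apply_mul_apply hs' hK hx hv, map_mul, mul_right_comm, sg_mul_self, one_mul]
    calc ∑ᶠ v ∈ V(K), sg (s' v) * (D + Pi.single x (sg a * p) + Pi.single y (sg b * q) : α → _) v
        = ∑ᶠ v ∈ V(K), sg (s x * s' x) * (sg (s v) * D v
            + sg (s v) * (Pi.single x (sg a * p) : α → ZMod 3) v +
            sg (s v) * (Pi.single y (sg b * q) : α → ZMod 3) v) :=
          finsum_mem_congr rfl fun v hv => by
            rw [hs'_eq v hv, Pi.add_apply, Pi.add_apply]
            ring
      _ = 0 := by
          rw [← mul_finsum_mem' _ _ (Set.toFinite _), finsum_mem_add_distrib (Set.toFinite _),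
            finsum_mem_add_distrib (Set.toFinite _), hsingle hx, hsingle hy]
          linear_combination sg (s x * s' x) * hab
  · exact ⟨1, 1, mem_boundarySpace hK ht fun s h => (hbal ⟨s, h⟩).elim⟩

lemma exists_isPotential_of_ncard_lt (hK : Connected K) (ht : IsEndLabelling K t)
    (hlt : E(K).ncard < V(K).ncard) (σ : β → ℤˣ) : ∃ s, IsPotential σ K s := by
  have := Fintype.ofFinite V(K)
  have := Fintype.ofFinite E(K)
  let f : (V(K) → ZMod 3) →ₗ[ZMod 3] (E(K) → ZMod 3) :=
    (LinearMap.pi fun e => LinearMap.proj (t e false) - sg (σ e) • LinearMap.proj (t e true)) ∘ₗ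
      Function.ExtendByZero.linearMap (ZMod 3) Subtype.val
  have hker : f.ker ≠ ⊥ := LinearMap.ker_ne_bot_of_finrank_lt <| by
    simpa only [Module.finrank_fintype_fun_eq_card, ← Nat.card_eq_fintype_card,
      Nat.card_coe_set_eq] using hlt
  obtain ⟨l, hl, hne⟩ := f.ker.exists_mem_ne_zero_of_ne_bot hker
  obtain ⟨v, hv⟩ := Function.ne_iff.1 hne
  have hrel : ∀ e x y, K.IsLink e x y → Function.extend Subtype.val l 0 x =
      sg (σ e) * Function.extend Subtype.val l 0 y := by
    intro e x y he
    have h : Function.extend Subtype.val l 0 (t e false) -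
        sg (σ e) * Function.extend Subtype.val l 0 (t e true) = 0 := congrFun hl ⟨e, he.edge_mem⟩
    obtain ⟨_ | _, rfl, rfl⟩ := ht.exists_of_isLink he
    · exact sub_eq_zero.1 h
    · simp only [Bool.not_true]
      linear_combination -sg (σ e) * h -
        Function.extend Subtype.val l 0 (t e true) * sg_mul_self (σ e)
  obtain ⟨s, hs, -⟩ := exists_isPotential_of_linear_relation hK hrel v.2
    (by rwa [Subtype.val_injective.extend_apply])
  exact ⟨s, hs⟩

end Boundary

section CyclesAndPaths

variable [Finite β] {C P : Graph α β} {t : β → Bool → α} {σ : β → ℤˣ}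

lemma sign_eq_mul_sign_deleteEdges {e : β} (he : e ∈ E(C)) (σ : β → ℤˣ) :
    sign σ C = σ e * sign σ (C.deleteEdges {e}) := by
  rw [sign, sign, Graph.edgeSet_deleteEdges,
    ← finprod_mem_insert _ (fun h => h.2 rfl) (Set.toFinite _), Set.insert_sdiff_self_of_mem he]

variable [Finite α]

lemma IsNegativeCycle.not_balanced (hC : IsNegativeCycle σ C) (ht : IsEndLabelling C t) :
    ¬ Balanced σ C := by
  rintro hbal
  obtain ⟨s, hs⟩ := balanced_iff_exists_isPotential.1 hbal
  exact absurd (hC.2.symm.trans (hs.sign_eq_one hC.1 ht)) (by decide)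

lemma IsPath.exists_isPotential {x y : α} (hP : IsPath P x y) (ht : IsEndLabelling P t)
    (σ : β → ℤˣ) : ∃ s, IsPotential σ P s := by
  obtain ⟨hconn, hx, -, -, hdx, hdy, hd⟩ := hP
  refine exists_isPotential_of_ncard_lt hconn ht (ncard_edgeSet_lt ht (fun v hv => ?_) hx ?_) σ
  · by_cases hvx : v = x
    · rw [hvx, hdx]
      exact one_le_two
    by_cases hvy : v = y
    · rw [hvy, hdy]
      exact one_le_two
    exact (hd v hv hvx hvy).le
  · rw [hdx]
    exact one_lt_two

lemma IsCycle.connected_deleteEdges (hC : IsCycle C) (ht : IsEndLabelling C t) (e : β) :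
    Connected (C.deleteEdges {e}) := by
  have ht' := ht.mono (C.deleteEdges_le (F := {e}))
  refine connected_of_forall_crossingEdges ht' hC.1.1 fun X x hx y hy hxX hyX => ?_
  obtain ⟨e', he'⟩ := hC.1.crossingEdges_nonempty ht hx hy hxX hyX
  have heven : Even (crossingEdges t E(C) X).ncard := even_ncard_crossingEdges fun v _ => by
    rw [← degree_eq_ncard_halfEdgesAt ht]
    by_cases hv : v ∈ V(C)
    · rw [hC.2 v hv]
      exact even_two
    · rw [degree_eq_zero_of_notMem ht hv]
      exact Even.zero
  have hpos : 0 < (crossingEdges t E(C) X).ncard := (Set.ncard_pos (Set.toFinite _)).2 ⟨e', he'⟩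
  obtain ⟨e'', he'', hne⟩ := Set.exists_ne_of_one_lt_ncard
    (show 1 < (crossingEdges t E(C) X).ncard by grind) e
  exact ⟨e'', ⟨by simpa using ⟨he''.1, hne⟩, he''.2⟩⟩

lemma IsCycle.exists_isPotential (hC : IsCycle C) (ht : IsEndLabelling C t)
    (hσ : sign σ C = 1) : ∃ s, IsPotential σ C s := by
  obtain ⟨v, hv⟩ := hC.1.1
  obtain ⟨⟨e, b⟩, he, rfl⟩ : (halfEdgesAt t E(C) v).Nonempty := by
    rw [← Set.ncard_pos (Set.toFinite _), ← degree_eq_ncard_halfEdgesAt ht, hC.2 v hv]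
    exact two_pos
  have hle : C.deleteEdges {e} ≤ C := Graph.deleteEdges_le
  have hdeg : degree (C.deleteEdges {e}) (t e b) < 2 := by
    rw [← hC.2 _ hv, ← degree_add_ncard_halfEdgesAt_sdiff ht hle, Nat.lt_add_right_iff_pos,
      Set.ncard_pos (Set.toFinite _)]
    exact ⟨(e, b), by simpa using he, rfl⟩
  obtain ⟨s, hs⟩ := exists_isPotential_of_ncard_lt (hC.connected_deleteEdges ht e) (ht.mono hle)
    (ncard_edgeSet_lt (ht.mono hle) (fun v hv => (degree_mono ht hle v).trans (hC.2 v hv).le) hv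
      hdeg) σ
  let τ : β → ℤˣ := fun e => s (t e false) * s (t e true)
  have hτ : sign τ C = 1 := IsPotential.sign_eq_one ((isPotential_iff ht).2 fun _ _ => rfl) hC ht
  have hsign : sign τ (C.deleteEdges {e}) = sign σ (C.deleteEdges {e}) :=
    finprod_mem_congr rfl ((isPotential_iff (ht.mono hle)).1 hs)
  rw [← hσ, sign_eq_mul_sign_deleteEdges he, sign_eq_mul_sign_deleteEdges he, hsign,
    mul_left_inj] at hτ
  refine ⟨s, (isPotential_iff ht).2 fun e' he' => ?_⟩
  by_cases hne : e' = e
  · exact hne ▸ hτ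
  · exact hs e' _ _ ((Graph.IsSubgraph.isLink_iff hle (by simpa using ⟨he', hne⟩)).2 (ht e' he'))

end CyclesAndPaths

/-! ### Preflows on half-edges -/

/-- The condition that a preflow imposes on its boundary `x` at a vertex of degree `d`. -/
def FitsDegree (x : ZMod 3) (d : ℕ) : Prop := x ≠ 0 ↔ d = 1 ∨ d = 2

lemma exists_fitsDegree (d : ℕ) : ∃ x, FitsDegree x d := by
  by_cases hd : d = 1 ∨ d = 2
  exacts [⟨1, by simp [FitsDegree, hd]⟩, ⟨0, by simp [FitsDegree, hd]⟩]

lemma fitsDegree_sg_mul {u : ℤˣ} {x : ZMod 3} {d : ℕ} :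
    FitsDegree (sg u * x) d ↔ FitsDegree x d := by
  simp [FitsDegree, sg_ne_zero]

lemma FitsDegree.exists_add_nsmul {x : ZMod 3} {d n : ℕ} (hx : FitsDegree x d) (hdn : d + n ≤ 3) :
    ∃ g ≠ 0, FitsDegree (x + n • g) (d + n) := by
  have hd : d ≤ 3 := by lia
  have hn : n ≤ 3 := by lia
  unfold FitsDegree at *
  interval_cases d <;> interval_cases n <;> first | lia | (revert x; decide)

/-- The values `c` on the half-edges of the edges in `F` satisfy the conditions that a preflow
imposes on these edges and on the vertices in `X`. Undivided edges have no defect and the edges in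
`S` have one, since a preflow has a nonzero boundary at the vertex that divides such an edge. Only
edges in `Z` may carry the value zero. -/
structure IsPartialPreflow (σ : β → ℤˣ) (S Z : Set β) (t : β → Bool → α) (R : Graph α β)
    (F : Set β) (X : Set α) (c : β × Bool → ZMod 3) : Prop where
  edgeDefect_ne_zero_iff : ∀ e ∈ F, edgeDefect σ c e ≠ 0 ↔ e ∈ S
  mem_of_eq_zero : ∀ e ∈ F, ∀ b, c (e, b) = 0 → e ∈ Z
  fitsDegree : ∀ v ∈ X, FitsDegree (halfEdgeSum t F c v) (degree R v)

/-- The half-edge values `c` describe a preflow of the signed graph obtained from `R` by subdividing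
the edges in `S`, with zeros confined to `Z`. -/
abbrev IsHalfPreflow (σ : β → ℤˣ) (S Z : Set β) (t : β → Bool → α) (R : Graph α β)
    (c : β × Bool → ZMod 3) : Prop :=
  IsPartialPreflow σ S Z t R E(R) V(R) c

/-- The half-edge values `c` describe a preflow everywhere but on the subgraph `C`, and do not
vanish on the half-edges that attach the other edges to `C`. -/
structure IsHalfPreflowOff (σ : β → ℤˣ) (S Z : Set β) (t : β → Bool → α) (R C : Graph α β)
    (c : β × Bool → ZMod 3) : Prop
    extends IsPartialPreflow σ S Z t R (E(R) \ E(C)) (V(R) \ V(C)) c where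
  ne_zero : ∀ e ∈ E(R) \ E(C), ∀ b, t e b ∈ V(C) → c (e, b) ≠ 0

section ExtendOff

variable {σ : β → ℤˣ} {S Z : Set β} {t : β → Bool → α} {R C : Graph α β} {c : β × Bool → ZMod 3}

lemma isHalfPreflow_of_vertexSet_eq_empty (h : V(R) = ∅) (c : β × Bool → ZMod 3) :
    IsHalfPreflow σ S Z t R c := by
  have hE : ∀ e, e ∉ E(R) := fun e he => by
    obtain ⟨x, y, hl⟩ := R.exists_isLink_of_mem_edgeSet he
    exact h.subset hl.left_mem
  exact ⟨fun e he => (hE e he).elim, fun e he => (hE e he).elim, by simp [h]⟩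

lemma mem_edgeSet_deleteVerts_iff (ht : IsEndLabelling R t) {e : β} (he : e ∈ E(R)) (X : Set α) :
    e ∈ E(R.deleteVerts X) ↔ ∀ b, t e b ∉ X := by
  constructor
  · intro h b
    have hmem := (ht.mono Graph.deleteVerts_le).mem h b
    rw [Graph.vertexSet_deleteVerts] at hmem
    exact hmem.2
  · exact fun h => ((Graph.deleteVerts_isLink R X).2 ⟨ht e he, h false, h true⟩).edge_mem

lemma halfEdgesAt_sdiff_of_notMem (ht : IsEndLabelling C t) {v : α} (hv : v ∉ V(C)) (F : Set β) :
    halfEdgesAt t (F \ E(C)) v = halfEdgesAt t F v :=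
  Set.Subset.antisymm (fun _ h => ⟨h.1.1, h.2⟩)
    fun _ h => ⟨⟨h.1, fun hC => hv (h.2 ▸ ht.mem hC _)⟩, h.2⟩

lemma exists_edge_values (σ : β → ℤˣ) {g : α → ZMod 3} (hg : ∀ v, g v ≠ 0) {e : β} {b : Bool}
    {X : Set α} (hb : t e b ∈ X) :
    ∃ w : Bool → ZMod 3, (∀ b, w b ≠ 0) ∧ w true + sg (σ e) * w false = 0 ∧
      ∀ b, t e b ∉ X → w b = g (t e b) := by
  refine ⟨fun b' => if b' = b then -sg (σ e) * g (t e !b) else g (t e !b), fun b' => ?_, ?_,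
    fun b' hb' => ?_⟩
  · beta_reduce
    split_ifs
    exacts [mul_ne_zero (neg_ne_zero.2 (sg_ne_zero _)) (hg _), hg _]
  · cases b <;> simp [← mul_assoc, sg_mul_self]
  · have hne : b' ≠ b := by
      rintro rfl
      exact hb' hb
    beta_reduce
    rw [if_neg hne, Bool.eq_not.2 hne]

lemma exists_halfEdge_values (σ : β → ℤˣ) {g : α → ZMod 3} (hg : ∀ v, g v ≠ 0) {F : Set β}
    {X : Set α} (hF : ∀ e ∈ F, ∃ b, t e b ∈ X) :
    ∃ w : β × Bool → ZMod 3, (∀ h, w h ≠ 0) ∧ (∀ e ∈ F, edgeDefect σ w e = 0) ∧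
      ∀ e ∈ F, ∀ b, t e b ∉ X → w (e, b) = g (t e b) := by
  have hedge : ∀ e, ∃ w : Bool → ZMod 3, (∀ b, w b ≠ 0) ∧ (e ∈ F →
      w true + sg (σ e) * w false = 0 ∧ ∀ b, t e b ∉ X → w b = g (t e b)) := by
    intro e
    by_cases he : e ∈ F
    · obtain ⟨b, hb⟩ := hF e he
      obtain ⟨w, hw, hw'⟩ := exists_edge_values σ hg hb
      exact ⟨w, hw, fun _ => hw'⟩
    · exact ⟨1, fun _ => one_ne_zero, fun h => (he h).elim⟩
  choose w hw hw' using hedge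
  exact ⟨fun h => w h.1 h.2, fun h => hw h.1 h.2, fun e he => (hw' e he).1,
    fun e he => (hw' e he).2⟩

variable [Finite β]

lemma exists_vertex_values (ht : IsEndLabelling R t) {R' : Graph α β} (hR' : R' ≤ R) {X : Set α}
    (hdeg : ∀ v ∈ X, degree R v ≤ 3)
    (hfit : ∀ v ∈ X, FitsDegree (halfEdgeSum t E(R') c v) (degree R' v)) :
    ∃ g : α → ZMod 3, (∀ v, g v ≠ 0) ∧ ∀ v ∈ X,
      FitsDegree (halfEdgeSum t E(R') c v + (halfEdgesAt t (E(R) \ E(R')) v).ncard • g v)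
        (degree R v) := by
  have hvalue : ∀ v, ∃ g ≠ 0, v ∈ X →
      FitsDegree (halfEdgeSum t E(R') c v + (halfEdgesAt t (E(R) \ E(R')) v).ncard • g)
        (degree R v) := by
    intro v
    by_cases hv : v ∈ X
    · have hd := degree_add_ncard_halfEdgesAt_sdiff ht hR' v
      obtain ⟨g, hg, hg'⟩ := (hfit v hv).exists_add_nsmul (hd.trans_le (hdeg v hv))
      exact ⟨g, hg, fun _ => hd ▸ hg'⟩
    · exact ⟨1, one_ne_zero, fun h => (hv h).elim⟩
  choose g hg hg' using hvalue
  exact ⟨g, hg, hg'⟩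

lemma IsHalfPreflow.exists_off (ht : IsEndLabelling R t) (hC : C ≤ R)
    (hdeg : ∀ v ∈ V(R), degree R v ≤ 3) (hS : ∀ e ∈ E(R) \ E(C), ∀ b, t e b ∈ V(C) → e ∉ S)
    {c' : β × Bool → ZMod 3} (hc' : IsHalfPreflow σ S Z t (R.deleteVerts V(C)) c') :
    ∃ c, IsHalfPreflowOff σ S Z t R C c := by
  classical
  set R' := R.deleteVerts V(C) with hR'
  have hle : R' ≤ R := Graph.deleteVerts_le
  have hmem {e : β} (he : e ∈ E(R)) : e ∈ E(R') ↔ ∀ b, t e b ∉ V(C) :=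
    mem_edgeSet_deleteVerts_iff ht he _
  have hatt {e : β} (he : e ∈ E(R) \ E(R')) : ∃ b, t e b ∈ V(C) := by
    by_contra! h
    exact he.2 ((hmem he.1).2 h)
  obtain ⟨g, hg, hfit⟩ := exists_vertex_values ht hle (fun v hv => hdeg v hv.1)
    (hR' ▸ hc'.fitsDegree : ∀ v ∈ V(R) \ V(C), _)
  obtain ⟨w, hw₀, hw, hwg⟩ := exists_halfEdge_values σ hg fun e => hatt
  let c : β × Bool → ZMod 3 := fun h => if h.1 ∈ E(R') then c' h else w h
  have hin {e : β} (he : e ∈ E(R')) (b : Bool) : c (e, b) = c' (e, b) := if_pos he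
  have hout {e : β} (he : e ∉ E(R')) (b : Bool) : c (e, b) = w (e, b) := if_neg he
  refine ⟨c, ⟨fun e he => ?_, fun e _ b h₀ => ?_, fun v hv => ?_⟩, fun e he b hb => ?_⟩
  · by_cases h : e ∈ E(R')
    · simpa only [edgeDefect, hin h] using hc'.edgeDefect_ne_zero_iff e h
    · obtain ⟨b, hb⟩ := hatt ⟨he.1, h⟩
      have hdef : edgeDefect σ c e = 0 := by
        simpa only [edgeDefect, hout h] using hw e ⟨he.1, h⟩
      simpa [hdef] using hS e he b hb
  · by_cases h : e ∈ E(R')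
    · exact hc'.mem_of_eq_zero e h b (hin h b ▸ h₀)
    · exact (hw₀ _ (hout h b ▸ h₀)).elim
  · have hsum : halfEdgeSum t (E(R) \ E(C)) c v =
        halfEdgeSum t E(R') c' v + (halfEdgesAt t (E(R) \ E(R')) v).ncard • g v := calc
      _ = halfEdgeSum t (E(R') ∪ E(R) \ E(R')) c v := by
        rw [halfEdgeSum, halfEdgesAt_sdiff_of_notMem (ht.mono hC) hv.2,
          Set.union_sdiff_cancel hle.edgeSet_mono, halfEdgeSum]
      _ = _ := by
        have hnew : ∀ p ∈ halfEdgesAt t (E(R) \ E(R')) v, c p = g v := fun p hp => by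
          rw [hout hp.1.2, hwg p.1 hp.1 p.2 (hp.2 ▸ hv.2), hp.2]
        rw [halfEdgeSum_union Set.disjoint_sdiff_right, halfEdgeSum_congr fun p hp => hin hp.1 p.2,
          halfEdgeSum_eq_nsmul hnew]
    exact hsum ▸ hfit v hv
  · have h : e ∉ E(R') := fun h => (hmem he.1).1 h b hb
    exact hout h b ▸ hw₀ _

end ExtendOff

section Extend

variable {σ : β → ℤˣ} {S Z : Set β} {t : β → Bool → α} {R C : Graph α β} {c : β × Bool → ZMod 3}

lemma IsHalfPreflowOff.glue [Finite β] (ht : IsEndLabelling R t) (hCR : C ≤ R)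
    (hc : IsHalfPreflowOff σ S Z t R C c) {d : β × Bool → ZMod 3}
    (hd : ∀ e ∈ E(C), edgeDefect σ d e ≠ 0 ↔ e ∈ S) (hZ : ∀ e ∈ E(C), ∀ b, d (e, b) = 0 → e ∈ Z)
    (hfit : ∀ v ∈ V(C), FitsDegree (halfEdgeSum t (E(R) \ E(C)) c v + halfEdgeSum t E(C) d v)
      (degree R v)) :
    ∃ f, IsHalfPreflow σ S Z t R f := by
  classical
  let f : β × Bool → ZMod 3 := fun h => if h.1 ∈ E(C) then d h else c h
  have hin {e : β} (he : e ∈ E(C)) (b : Bool) : f (e, b) = d (e, b) := if_pos he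
  have hout {e : β} (he : e ∉ E(C)) (b : Bool) : f (e, b) = c (e, b) := if_neg he
  refine ⟨f, fun e he => ?_, fun e he b h₀ => ?_, fun v hv => ?_⟩
  · by_cases h : e ∈ E(C)
    · simpa only [edgeDefect, hin h] using hd e h
    · simpa only [edgeDefect, hout h] using hc.edgeDefect_ne_zero_iff e ⟨he, h⟩
  · by_cases h : e ∈ E(C)
    · exact hZ e h b (hin h b ▸ h₀)
    · exact hc.mem_of_eq_zero e ⟨he, h⟩ b (hout h b ▸ h₀)
  · have hsum : halfEdgeSum t E(R) f v =
        halfEdgeSum t (E(R) \ E(C)) c v + halfEdgeSum t E(C) d v := calc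
      _ = halfEdgeSum t (E(R) \ E(C) ∪ E(C)) f v := by
        rw [Set.sdiff_union_of_subset hCR.edgeSet_mono]
      _ = _ := by
        rw [halfEdgeSum_union Set.disjoint_sdiff_left,
          halfEdgeSum_congr fun p hp => hout hp.1.2 p.2, halfEdgeSum_congr fun p hp => hin hp.1 p.2]
    rw [hsum]
    by_cases h : v ∈ V(C)
    · exact hfit v h
    · rw [halfEdgeSum_of_notMem (ht.mono hCR) h, add_zero]
      exact hc.fitsDegree v ⟨hv, h⟩

lemma halfEdgeSum_sdiff_eq_zero [Finite β] (ht : IsEndLabelling R t) (hCR : C ≤ R) {v : α}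
    (hv : degree R v ≤ degree C v) : halfEdgeSum t (E(R) \ E(C)) c v = 0 :=
  halfEdgeSum_of_halfEdgesAt_eq_empty (halfEdgesAt_sdiff_eq_empty ht hCR hv) c

lemma IsHalfPreflowOff.halfEdgeSum_sdiff_ne_zero [Finite β] (ht : IsEndLabelling R t)
    (hCR : C ≤ R) (hc : IsHalfPreflowOff σ S Z t R C c) {v : α} (hv : v ∈ V(C))
    (hd : degree R v = degree C v + 1) : halfEdgeSum t (E(R) \ E(C)) c v ≠ 0 := by
  have hcard := degree_add_ncard_halfEdgesAt_sdiff ht hCR v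
  obtain ⟨p, hp⟩ := Set.ncard_eq_one.1 (by lia : (halfEdgesAt t (E(R) \ E(C)) v).ncard = 1)
  have hmem : p ∈ halfEdgesAt t (E(R) \ E(C)) v := hp ▸ rfl
  rw [halfEdgeSum, hp, finsum_mem_singleton]
  exact hc.ne_zero p.1 hmem.1 p.2 (hmem.2 ▸ hv)

lemma IsHalfPreflowOff.extend_negativeCycle [Finite α] [Finite β] (ht : IsEndLabelling R t)
    (hCR : C ≤ R) (hc : IsHalfPreflowOff σ S Z t R C c) (hC : IsNegativeCycle σ C)
    (hZ : E(C) ⊆ Z) : ∃ f, IsHalfPreflow σ S Z t R f := by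
  classical
  choose D hD using fun v => exists_fitsDegree (degree R v)
  let r : β × Bool → ZMod 3 := fun h => if h.1 ∈ S ∧ h.2 = true then 1 else 0
  have hr (e : β) : edgeDefect σ r e ≠ 0 ↔ e ∈ S := by simp [edgeDefect, r]
  have htop := boundarySpace_eq_top hC.1.1 (ht.mono hCR) (hC.not_balanced (ht.mono hCR))
  obtain ⟨d, hd, hsum⟩ : (fun v => D v - halfEdgeSum t (E(R) \ E(C)) c v - halfEdgeSum t E(C) r v) ∈
      boundarySpace σ t C := htop ▸ Submodule.mem_top
  refine hc.glue ht hCR (d := d + r) (fun e _ => ?_) (fun e he _ _ => hZ he) fun v hv => ?_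
  · rw [edgeDefect_add, hd, zero_add, hr]
  · rw [halfEdgeSum_add, hsum v hv]
    convert hD v using 1
    ring

lemma exists_isHalfPreflow_of_forall_sign [Finite α] [Finite β] (ht : IsEndLabelling R t)
    (hCR : C ≤ R) (hC : IsCycle C) (hZ : E(C) ⊆ Z) (hS : ∀ e ∈ E(C), e ∉ S) {x y : α}
    (hx : x ∈ V(C)) (hy : y ∈ V(C)) (hxy : x ≠ y) (hdx : degree R x = 2) {q : ZMod 3} (hq : q ≠ 0)
    {B : α → ZMod 3} (h : ∀ u : ℤˣ, ∃ c, IsHalfPreflowOff σ S Z t R C c ∧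
      FitsDegree (halfEdgeSum t (E(R) \ E(C)) c y + sg u * q) (degree R y) ∧
      ∀ v ∈ V(C), v ≠ y → halfEdgeSum t (E(R) \ E(C)) c v = B v) :
    ∃ f, IsHalfPreflow σ S Z t R f := by
  classical
  choose D hD using fun v => exists_fitsDegree (degree R v)
  obtain ⟨a, b, d, hd, hsum⟩ := exists_add_single_mem_boundarySpace (σ := σ) hC.1 (ht.mono hCR)
    (fun v => if v = x ∨ v = y then 0 else D v - B v) hx hy (one_ne_zero (α := ZMod 3)) hq
  obtain ⟨c, hc, hfit, hB⟩ := h b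
  refine hc.glue ht hCR (d := d) (fun e he => by simp [hd, hS e he]) (fun e he _ _ => hZ he)
    fun v hv => ?_
  rw [hsum v hv]
  obtain rfl | hvy := eq_or_ne v y
  · simpa [hxy.symm] using hfit
  obtain rfl | hvx := eq_or_ne v x
  · rw [halfEdgeSum_sdiff_eq_zero ht hCR (by rw [hdx, hC.2 v hv]), hdx]
    simp [hxy, FitsDegree, sg_ne_zero]
  · simpa [hvx, hvy, hB v hv hvy] using hD v

lemma IsHalfPreflowOff.extend_cycle_of_two_le_ncard [Finite α] [Finite β]
    (ht : IsEndLabelling R t) (hCR : C ≤ R) (hc : IsHalfPreflowOff σ S Z t R C c) (hC : IsCycle C)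
    (hZ : E(C) ⊆ Z) (hS : ∀ e ∈ E(C), e ∉ S) (h : 2 ≤ {v ∈ V(C) | degree R v = 2}.ncard) :
    ∃ f, IsHalfPreflow σ S Z t R f := by
  obtain ⟨x, hx, y, hy, hxy⟩ := (Set.one_lt_ncard (Set.toFinite _)).1 h
  refine exists_isHalfPreflow_of_forall_sign ht hCR hC hZ hS hx.1 hy.1 hxy hx.2 one_ne_zero
    fun u => ⟨c, hc, ?_, fun v _ _ => rfl⟩
  rw [halfEdgeSum_sdiff_eq_zero ht hCR (by rw [hy.2, hC.2 y hy.1]), hy.2]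
  simp [FitsDegree, sg_ne_zero]

/-- The set `A` of vertices avoids `C`, and the edges outside `C` at the vertex `y` of `C` form the
cut between `A` and the remaining vertices. -/
structure IsAttachedAt (t : β → Bool → α) (R C : Graph α β) (y : α) (A : Set α) : Prop where
  mem : y ∈ V(C)
  disjoint : Disjoint V(C) A
  mem_or_eq : ∀ e ∈ E(R), ∀ b, t e b ∈ A → t e (!b) ∈ A ∨ t e (!b) = y
  mem_of_eq : ∀ e ∈ E(R) \ E(C), ∀ b, t e b = y → t e (!b) ∈ A

lemma IsHalfPreflowOff.exists_sg_mul [Finite β] {y : α} {A : Set α} (hA : IsAttachedAt t R C y A)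
    (hc : IsHalfPreflowOff σ S Z t R C c) (u : ℤˣ) :
    ∃ c', IsHalfPreflowOff σ S Z t R C c' ∧
      halfEdgeSum t (E(R) \ E(C)) c' y = sg u * halfEdgeSum t (E(R) \ E(C)) c y ∧
      ∀ v ∈ V(C), v ≠ y →
        halfEdgeSum t (E(R) \ E(C)) c' v = halfEdgeSum t (E(R) \ E(C)) c v := by
  classical
  let m (e : β) : ZMod 3 := sg (if ∃ b, t e b ∈ A then u else 1)
  have hy : halfEdgeSum t (E(R) \ E(C)) (fun h => m h.1 * c h) y =
      sg u * halfEdgeSum t (E(R) \ E(C)) c y := by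
    rw [← halfEdgeSum_const_mul]
    refine halfEdgeSum_congr fun p hp => ?_
    simp only [m, if_pos (⟨_, hA.mem_of_eq p.1 hp.1 p.2 hp.2⟩ : ∃ b, t p.1 b ∈ A)]
  have hne {v : α} (hv : v ≠ y) : halfEdgeSum t (E(R) \ E(C)) (fun h => m h.1 * c h) v =
      sg (if v ∈ A then u else 1) * halfEdgeSum t (E(R) \ E(C)) c v := by
    rw [← halfEdgeSum_const_mul]
    refine halfEdgeSum_congr fun p hp => ?_
    have hiff : (∃ b, t p.1 b ∈ A) ↔ v ∈ A := by
      refine ⟨fun ⟨b, hb⟩ => ?_, fun h => ⟨p.2, hp.2.symm ▸ h⟩⟩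
      by_contra hvA
      have hb' : p.2 = !b := Bool.eq_not.2 fun h => hvA (hp.2 ▸ h ▸ hb)
      have := hA.mem_or_eq p.1 hp.1.1 b hb
      rw [← hb', hp.2] at this
      exact this.elim hvA hv
    simp only [m, hiff]
  refine ⟨fun h => m h.1 * c h, ⟨⟨fun e he => ?_, fun e he b h₀ => ?_, fun v hv => ?_⟩,
    fun e he b hb => ?_⟩, hy, fun v hv hvy => ?_⟩
  · rw [← hc.edgeDefect_ne_zero_iff e he]
    exact ((edgeDefect_const_mul (m e) c e).symm ▸ mul_ne_zero_iff_left (sg_ne_zero _))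
  · exact hc.mem_of_eq_zero e he b ((mul_eq_zero.1 h₀).resolve_left (sg_ne_zero _))
  · rw [hne (ne_of_mem_of_not_mem hA.mem hv.2).symm, fitsDegree_sg_mul]
    exact hc.fitsDegree v hv
  · exact mul_ne_zero (sg_ne_zero _) (hc.ne_zero e he b hb)
  · rw [hne hvy, if_neg (hA.disjoint.notMem_of_mem_left hv), map_one, one_mul]

lemma IsHalfPreflowOff.extend_cycle_of_isAttachedAt [Finite α] [Finite β]
    (ht : IsEndLabelling R t) (hCR : C ≤ R) (hc : IsHalfPreflowOff σ S Z t R C c) (hC : IsCycle C)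
    (hZ : E(C) ⊆ Z) (hS : ∀ e ∈ E(C), e ∉ S) {x y : α} (hx : x ∈ V(C)) (hxy : x ≠ y)
    (hdx : degree R x = 2) (hdy : degree R y = 3) {A : Set α} (hA : IsAttachedAt t R C y A) :
    ∃ f, IsHalfPreflow σ S Z t R f := by
  have hy := hc.halfEdgeSum_sdiff_ne_zero ht hCR hA.mem (by rw [hdy, hC.2 y hA.mem])
  refine exists_isHalfPreflow_of_forall_sign ht hCR hC hZ hS hx hA.mem hxy hdx (neg_ne_zero.2 hy)
    (B := halfEdgeSum t (E(R) \ E(C)) c) fun u => ?_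
  obtain ⟨c', hc', hc'y, hc'v⟩ := hc.exists_sg_mul hA u
  exact ⟨c', hc', by simp [hc'y, hdy, FitsDegree], hc'v⟩

lemma sign_twist [Finite β] (σ : β → ℤˣ) (S : Set β) [DecidablePred (· ∈ S)] (C : Graph α β) :
    sign (fun e => if e ∈ S then σ e else -σ e) C = (-1) ^ (E(C) \ S).ncard * sign σ C := by
  have hfactor : ∀ e, (if e ∈ S then σ e else -σ e) = (if e ∈ S then 1 else -1) * σ e :=
    fun e => by split_ifs <;> simp
  have hsplit : E(C) = E(C) ∩ S ∪ E(C) \ S := (Set.inter_union_sdiff _ _).symm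
  rw [sign, sign, finprod_mem_congr rfl fun e _ => hfactor e,
    finprod_mem_mul_distrib (Set.toFinite _)]
  congr 1
  rw [hsplit, finprod_mem_union (Set.disjoint_sdiff_inter.symm) (Set.toFinite _) (Set.toFinite _),
    finprod_mem_eq_one_of_forall_eq_one fun e he => if_pos he.2, one_mul,
    finprod_mem_eq_pow_ncard (Set.toFinite _) fun e he => if_neg he.2]
  simp

lemma edgeDefect_sg_eq_zero_iff {s : α → ℤˣ} {e : β} :
    edgeDefect σ (fun h => sg (s (t h.1 h.2))) e = 0 ↔ s (t e false) * s (t e true) = -σ e := by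
  simp only [edgeDefect]
  generalize s (t e false) = a, s (t e true) = b, σ e = u
  revert a b u
  decide

lemma IsNegativeCycle.exists_twisted_potential [Finite α] [Finite β] (ht : IsEndLabelling C t)
    (hC : IsNegativeCycle σ C) (hodd : Odd (E(C) \ S).ncard) {X : Set α} (hX : X.Subsingleton)
    (u : α → ℤˣ) : ∃ s : α → ℤˣ, (∀ v ∈ X, s v = u v) ∧
      ∀ e ∈ E(C), edgeDefect σ (fun h => sg (s (t h.1 h.2))) e ≠ 0 ↔ e ∈ S := by
  classical
  obtain ⟨s, hs⟩ := hC.1.exists_isPotential ht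
    (σ := fun e => if e ∈ S then σ e else -σ e) (by rw [sign_twist, hodd.neg_one_pow, hC.2]; rfl)
  rw [isPotential_iff ht] at hs
  have hscale (a : ℤˣ) : ∀ e ∈ E(C),
      edgeDefect σ (fun h => sg (a * s (t h.1 h.2))) e ≠ 0 ↔ e ∈ S := fun e he => by
    have hmul : a * s (t e false) * (a * s (t e true)) = if e ∈ S then σ e else -σ e := by
      rw [mul_mul_mul_comm, Int.units_mul_self, one_mul, hs e he]
    rw [ne_eq, edgeDefect_sg_eq_zero_iff (s := fun v => a * s v), hmul]
    split_ifs with h <;> simp [h, units_ne_neg_self]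
  obtain rfl | ⟨v, rfl⟩ := hX.eq_empty_or_singleton
  · exact ⟨fun v => 1 * s v, by simp, hscale 1⟩
  · refine ⟨fun w => u v * s v * s w, ?_, hscale _⟩
    rintro w rfl
    change u w * s w * s w = u w
    rw [mul_assoc, Int.units_mul_self, mul_one]

lemma IsHalfPreflowOff.extend_odd_negativeCycle [Finite α] [Finite β] (ht : IsEndLabelling R t)
    (hCR : C ≤ R) (hdeg : ∀ v ∈ V(R), degree R v ≤ 3) (hc : IsHalfPreflowOff σ S Z t R C c)
    (hC : IsNegativeCycle σ C) (hodd : Odd (E(C) \ S).ncard)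
    (hX : {v ∈ V(C) | degree R v ≠ 2}.Subsingleton) : ∃ f, IsHalfPreflow σ S Z t R f := by
  have hsign : ∀ v, ∃ u, halfEdgeSum t (E(R) \ E(C)) c v ≠ 0 →
      sg u = halfEdgeSum t (E(R) \ E(C)) c v := fun v => by
    by_cases h : halfEdgeSum t (E(R) \ E(C)) c v = 0
    exacts [⟨1, fun h' => (h' h).elim⟩, (exists_sg_eq h).imp fun _ hu _ => hu]
  choose u hu using hsign
  obtain ⟨s, hsu, hs⟩ := hC.exists_twisted_potential (ht.mono hCR) hodd hX u
  refine hc.glue ht hCR hs (fun e _ b h => (sg_ne_zero _ h).elim) fun v hv => ?_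
  have hdC := hC.1.2 v hv
  rw [halfEdgeSum_eq_nsmul (F := E(C)) (a := sg (s v)) fun p hp => by rw [hp.2],
    ← degree_eq_ncard_halfEdgesAt (ht.mono hCR), hdC]
  by_cases hd : degree R v = 2
  · rw [halfEdgeSum_sdiff_eq_zero ht hCR (by rw [hd, hdC]), hd]
    generalize s v = a
    revert a
    unfold FitsDegree
    decide
  · have h3 : degree R v = 3 := by
      have := degree_mono ht hCR v
      have := hdeg v (hCR.vertexSet_mono hv)
      lia
    have hne := hc.halfEdgeSum_sdiff_ne_zero ht hCR hv (by rw [h3, hdC])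
    rw [← hu v hne, hsu v ⟨hv, hd⟩, h3]
    generalize u v = a
    revert a
    unfold FitsDegree
    decide

lemma IsHalfPreflowOff.extend_noEdge [Finite β] (ht : IsEndLabelling R t) {v : α}
    (hle : Graph.noEdge {v} β ≤ R) (hd : degree R v ≤ 1)
    (hc : IsHalfPreflowOff σ S Z t R (Graph.noEdge {v} β) c) :
    ∃ f, IsHalfPreflow σ S Z t R f := by
  have hd₀ : degree (Graph.noEdge {v} β) v = 0 := by
    simp [degree_eq_ncard_halfEdgesAt (ht.mono hle), halfEdgesAt]
  refine hc.glue ht hle (d := 0) (by simp) (by simp) ?_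
  rintro w rfl
  obtain h | h := Nat.le_one_iff_eq_zero_or_eq_one.1 hd
  · rw [halfEdgeSum_sdiff_eq_zero ht hle (by lia), h]
    simp [FitsDegree, halfEdgeSum, halfEdgesAt]
  · have hne := hc.halfEdgeSum_sdiff_ne_zero ht hle rfl (by lia)
    rw [h]
    simpa [FitsDegree, halfEdgeSum, halfEdgesAt] using hne

end Extend

/-! ### Leaf-blocks -/

section Reach

variable {G H K : Graph α β} {x y z : α}

lemma Reach.mono (hle : H ≤ K) (h : Reach H x y) : Reach K x y :=
  Relation.ReflTransGen.mono (fun _ _ hadj => Graph.Adj.mono hle hadj) _ _ h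

lemma Reach.symm (h : Reach K x y) : Reach K y x := by
  unfold Reach at *
  induction h with
  | refl => exact .refl
  | tail _ hadj ih => exact .head hadj.symm ih

lemma Reach.trans (h : Reach K x y) (h' : Reach K y z) : Reach K x z :=
  Relation.ReflTransGen.trans h h'

lemma Reach.mem_of_forall_adj {X : Set α} (h : Reach K x y) (hx : x ∈ X)
    (hX : ∀ a ∈ X, ∀ b, K.Adj a b → b ∈ X) : y ∈ X := by
  unfold Reach at h
  induction h with
  | refl => exact hx
  | tail _ hadj ih => exact hX _ ih _ hadj

lemma deleteVerts_adj {X : Set α} : (K.deleteVerts X).Adj x y ↔ K.Adj x y ∧ x ∉ X ∧ y ∉ X := by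
  simp only [Graph.Adj, Graph.deleteVerts_isLink, exists_and_right]

/-- Contracting the excursions into `D`, which start and end in `c`, turns a walk into one that
avoids `D`. -/
lemma Reach.deleteVerts {D : Set α} {c : α} (h : Reach K x y) (hx : x ∉ D) (hy : y ∉ D)
    (hD : ∀ a ∈ D, ∀ b ∉ D, K.Adj a b → b = c) : Reach (K.deleteVerts D) x y := by
  classical
  let f : α → α := fun v => if v ∈ D then c else v
  have hstep : ∀ a b, K.Adj a b → Reach (K.deleteVerts D) (f a) (f b) := fun a b hab => by
    by_cases ha : a ∈ D <;> by_cases hb : b ∈ D <;> simp only [f, ha, hb, if_true, if_false]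
    · exact .refl
    · exact hD a ha b hb hab ▸ .refl
    · exact hD b hb a ha hab.symm ▸ .refl
    · exact .single (deleteVerts_adj.2 ⟨hab, ha, hb⟩)
  have hf : Reach (K.deleteVerts D) (f x) (f y) := Relation.ReflTransGen.lift' f hstep _ _ h
  simpa only [f, if_neg hx, if_neg hy] using hf

lemma le_deleteVerts {X : Set α} (hle : H ≤ K) (hX : Disjoint V(H) X) : H ≤ K.deleteVerts X where
  vertexSet_mono _ hv := ⟨hle.vertexSet_mono hv, hX.notMem_of_mem_left hv⟩
  isLink_mono _ _ _ hl := (Graph.deleteVerts_isLink _ _).2 ⟨hl.mono hle,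
    hX.notMem_of_mem_left hl.left_mem, hX.notMem_of_mem_left hl.right_mem⟩

lemma deleteVerts_mono (hle : H ≤ K) (X : Set α) : H.deleteVerts X ≤ K.deleteVerts X :=
  le_deleteVerts (Graph.deleteVerts_le.trans hle) Set.disjoint_sdiff_left

lemma reach_deleteVerts_singleton (hconn : Connected H) (hcut : ∀ v, ¬ IsCutVertex H v) {c : α}
    (hx : x ∈ V(H)) (hy : y ∈ V(H)) (hxc : x ≠ c) (hyc : y ≠ c) :
    Reach (H.deleteVerts {c}) x y := by
  by_cases hc : c ∈ V(H)
  · by_contra hn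
    exact hcut c ⟨hc, x, hx, y, hy, hxc, hyc, hconn.2 x hx y hy, hn⟩
  · exact (hconn.2 x hx y hy).mono (le_deleteVerts le_rfl (Set.disjoint_singleton_right.2 hc))

/-- A connected graph without cut vertices keeps these properties when vertices are added that
stay attached to it after the removal of any other vertex. -/
lemma Connected.of_forall_reach (hle : H ≤ K) (hconn : Connected H)
    (hcut : ∀ v, ¬ IsCutVertex H v) (hr : ∀ c, ∀ x ∈ V(K), x ∉ V(H) → x ≠ c →
      ∃ h ∈ V(H), h ≠ c ∧ Reach (K.deleteVerts {c}) x h) :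
    Connected K ∧ ∀ v, ¬ IsCutVertex K v := by
  constructor
  · obtain ⟨h₀, hh₀⟩ := hconn.1
    have hall : ∀ x ∈ V(K), Reach K x h₀ := fun x hx => by
      by_cases hxH : x ∈ V(H)
      · exact (hconn.2 x hxH h₀ hh₀).mono hle
      · obtain ⟨h, hh, -, hxh⟩ := hr h₀ x hx hxH fun h => hxH (h ▸ hh₀)
        exact (hxh.mono Graph.deleteVerts_le).trans ((hconn.2 h hh h₀ hh₀).mono hle)
    exact ⟨⟨h₀, hle.vertexSet_mono hh₀⟩, fun x hx y hy => (hall x hx).trans (hall y hy).symm⟩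
  · rintro c ⟨-, x, hx, y, hy, hxc, hyc, -, hn⟩
    have hall : ∀ x ∈ V(K), x ≠ c → ∃ h ∈ V(H), h ≠ c ∧ Reach (K.deleteVerts {c}) x h := by
      intro x hx hxc
      by_cases hxH : x ∈ V(H)
      exacts [⟨x, hxH, hxc, .refl⟩, hr c x hx hxH hxc]
    obtain ⟨h₁, hh₁, hc₁, hr₁⟩ := hall x hx hxc
    obtain ⟨h₂, hh₂, hc₂, hr₂⟩ := hall y hy hyc
    have hH := reach_deleteVerts_singleton hconn hcut hh₁ hh₂ hc₁ hc₂
    exact hn (hr₁.trans ((hH.mono (deleteVerts_mono hle _)).trans hr₂.symm))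

end Reach

section Block

variable {R H C : Graph α β} {t : β → Bool → α}

/-- Otherwise delete as many vertices outside the block as possible without separating `w'` from
the block in the absence of `w`. The graph that remains has no cut vertices and contains `e`. -/
lemma IsBlock.notMem_of_reach [Finite α] (hH : IsBlock R H) {e : β} {w w' u : α}
    (hl : R.IsLink e w w') (hw : w ∈ V(H)) (he : e ∉ E(H))
    (hr : Reach (R.deleteVerts {w}) w' u) : u ∉ V(H) := by
  intro hu
  obtain ⟨W, -, ⟨hW, hw'W, hWr⟩, hmax⟩ := exists_maximal_ge_of_wellFoundedGT
    (fun W : Set α => Disjoint V(H) W ∧ w' ∉ W ∧ Reach ((R.deleteVerts W).deleteVerts {w}) w' u) ∅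
    (by simpa using hr)
  set G := R.deleteVerts W with hG
  have hle : H ≤ G := le_deleteVerts hH.1.1 hW
  have heG : G.IsLink e w w' :=
    (Graph.deleteVerts_isLink _ _).2 ⟨hl, hW.notMem_of_mem_left hw, hw'W⟩
  have hGcut : Connected G ∧ ∀ v, ¬ IsCutVertex G v := by
    refine Connected.of_forall_reach hle hH.1.2.1 hH.1.2.2 fun c x hx _ hxc => ?_
    by_contra! hsep
    let D : Set α := {v | Reach (G.deleteVerts {c}) x v}
    have hcD : c ∉ D := fun h => (Reach.mem_of_forall_adj (X := {c}ᶜ) h hxc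
      fun a _ b hab => (deleteVerts_adj.1 hab).2.2) rfl
    have hDH : Disjoint V(H) D := Set.disjoint_left.2 fun v hv hvD =>
      hsep v hv (ne_of_mem_of_not_mem hvD hcD) hvD
    have hD : ∀ a ∈ D, ∀ b ∉ D, G.Adj a b → b = c := fun a ha b hb hab => by
      by_contra hbc
      exact hb (ha.tail (deleteVerts_adj.2 ⟨hab, ne_of_mem_of_not_mem ha hcD, hbc⟩))
    have hw'D : w' ∉ D := fun h => by
      obtain rfl := hD w' h w (hDH.notMem_of_mem_left hw) ⟨e, heG.symm⟩
      exact hDH.notMem_of_mem_left hu (Reach.trans h hWr)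
    have hDr := hWr.deleteVerts hw'D (hDH.notMem_of_mem_left hu)
      fun a ha b hb hab => hD a ha b hb (deleteVerts_adj.1 hab).1
    have hDW : W ∪ D ⊆ W := hmax ⟨Set.disjoint_union_right.2 ⟨hW, hDH⟩, fun h => h.elim hw'W hw'D,
      Relation.ReflTransGen.mono (fun a b hab => by simp_all [deleteVerts_adj]) _ _ hDr⟩
      Set.subset_union_left
    exact hx.2 (hDW (Or.inr .refl))
  exact he ((hH.2 ⟨Graph.deleteVerts_le, hGcut⟩ hle).edgeSet_mono heG.edge_mem)

lemma IsBlock.isCutVertex_of_isLink [Finite α] (hH : IsBlock R H) {e : β} {w w' : α}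
    (hl : R.IsLink e w w') (hw : w ∈ V(H)) (he : e ∉ E(H)) : IsCutVertex R w := by
  have hw' : w' ∉ V(H) := hH.notMem_of_reach hl hw he .refl
  by_cases hu : ∃ u ∈ V(H), u ≠ w
  · obtain ⟨u, hu, huw⟩ := hu
    exact ⟨hl.left_mem, w', hl.right_mem, u, hH.1.1.vertexSet_mono hu, fun h => hw' (h ▸ hw), huw,
      .head ⟨e, hl.symm⟩ ((hH.1.2.1.2 w hw u hu).mono hH.1.1),
      fun hr => hH.notMem_of_reach hl hw he hr hu⟩
  · push Not at hu
    have hadj : (R.induce {w, w'}).Adj w w' := ⟨e, hl, Or.inl rfl, Or.inr rfl⟩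
    have hconn : Connected (R.induce {w, w'}) := by
      refine ⟨⟨w, Or.inl rfl⟩, ?_⟩
      rintro x (rfl | rfl) y (rfl | rfl)
      exacts [.refl, .single hadj, .single hadj.symm, .refl]
    have hcut : ∀ v, ¬ IsCutVertex (R.induce {w, w'}) v := by
      rintro v ⟨hv, x, hx, y, hy, hxv, hyv, -, hn⟩
      have hxy : x = y := by
        simp only [Graph.vertexSet_induce, Set.mem_insert_iff, Set.mem_singleton_iff] at hv hx hy
        grind
      exact hn (hxy ▸ .refl)
    have hsub : ({w, w'} : Set α) ⊆ V(R) := Set.pair_subset hl.left_mem hl.right_mem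
    have hle : H ≤ R.induce {w, w'} :=
      ⟨fun v hv => Or.inl (hu v hv), fun _ _ _ hf =>
        ⟨hf.mono hH.1.1, Or.inl (hu _ hf.left_mem), Or.inl (hu _ hf.right_mem)⟩⟩
    exact absurd ((hH.2 ⟨Graph.induce_le hsub, hconn, hcut⟩ hle).vertexSet_mono (Or.inr rfl)) hw'

lemma IsLeafBlock.eq_of_edges [Finite α] (ht : IsEndLabelling R t) (hH : IsLeafBlock R H)
    {e e' : β} (he : e ∈ E(R) \ E(H)) (he' : e' ∈ E(R) \ E(H)) {b b' : Bool}
    (hb : t e b ∈ V(H)) (hb' : t e' b' ∈ V(H)) : t e b = t e' b' :=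
  hH.2 ⟨hb, hH.1.isCutVertex_of_isLink (ht.isLink he.1 b) hb he.2⟩
    ⟨hb', hH.1.isCutVertex_of_isLink (ht.isLink he'.1 b') hb' he'.2⟩

lemma exists_edge_of_degree_ne [Finite β] (ht : IsEndLabelling R t) (hHR : H ≤ R) {v : α}
    (h : degree R v ≠ degree H v) : ∃ e ∈ E(R) \ E(H), ∃ b, t e b = v := by
  have hadd := degree_add_ncard_halfEdgesAt_sdiff ht hHR v
  obtain ⟨⟨e, b⟩, he, hb⟩ := Set.nonempty_of_ncard_ne_zero
    (s := halfEdgesAt t (E(R) \ E(H)) v) (by omega)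
  exact ⟨e, he, b, hb⟩

lemma IsLeafBlock.eq_of_degree_ne [Finite α] [Finite β] (ht : IsEndLabelling R t)
    (hH : IsLeafBlock R H) {x y : α} (hx : x ∈ V(H)) (hy : y ∈ V(H))
    (hdx : degree R x ≠ degree H x) (hdy : degree R y ≠ degree H y) : x = y := by
  obtain ⟨e, he, b, rfl⟩ := exists_edge_of_degree_ne ht hH.1.1.1 hdx
  obtain ⟨e', he', b', rfl⟩ := exists_edge_of_degree_ne ht hH.1.1.1 hdy
  exact hH.eq_of_edges ht he he' hx hy

/-- The third edge at `w` would lead to a vertex that `w` separates from the rest of the cycle. -/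
lemma IsCycle.eq_of_degree_ne_two [Finite β] (hC : IsCycle C) (ht : IsEndLabelling H t)
    (hconn : Connected H) (hcut : ∀ v, ¬ IsCutVertex H v) (hCH : C ≤ H) {u w : α} (hw : w ∈ V(C))
    (hdw : degree H w ≤ 3) (hw2 : degree H w ≠ 2)
    (hdeg : ∀ v ∈ V(C), v ≠ w → degree H v = 2) (hu : u ∈ V(C)) : u = w := by
  by_contra huw
  have hin : ∀ f ∈ E(H), ∀ b, t f b ∈ V(C) → t f b ≠ w → f ∈ E(C) := fun f hf b hfC hfw => by
    by_contra hfn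
    have hempty := halfEdgesAt_sdiff_eq_empty ht hCH
      (v := t f b) (by rw [hdeg _ hfC hfw, hC.2 _ hfC])
    exact Set.eq_empty_iff_forall_notMem.1 hempty (f, b) ⟨⟨hf, hfn⟩, rfl⟩
  have hadd := degree_add_ncard_halfEdgesAt_sdiff ht hCH w
  have hmono := degree_mono ht hCH w
  rw [hC.2 w hw] at hadd hmono
  obtain ⟨⟨e, b⟩, heq⟩ := Set.ncard_eq_one.1
    (show (halfEdgesAt t (E(H) \ E(C)) w).ncard = 1 by omega)
  obtain ⟨he, -⟩ : e ∈ E(H) \ E(C) ∧ t e b = w := heq.ge rfl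
  have hloop : t e (!b) ≠ w := fun h => by
    have := heq.le (show (e, !b) ∈ halfEdgesAt t (E(H) \ E(C)) w from ⟨he, h⟩)
    simp at this
  have hout : t e (!b) ∉ V(C) := fun h => he.2 (hin e he.1 _ h hloop)
  have hr := reach_deleteVerts_singleton hconn hcut (hCH.vertexSet_mono hu) (ht.mem he.1 (!b)) huw
    hloop
  refine hout (hr.mem_of_forall_adj hu fun a ha v hav => ?_)
  obtain ⟨⟨f, hf⟩, haw, -⟩ := deleteVerts_adj.1 hav
  obtain ⟨b', rfl, rfl⟩ := ht.exists_of_isLink hf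
  exact (ht.mono hCH).mem (hin f hf.edge_mem b' ha haw) _

lemma IsLeafBlock.subsingleton_of_isCycle [Finite α] [Finite β] (ht : IsEndLabelling R t)
    (hH : IsLeafBlock R H) (hdeg : ∀ v ∈ V(R), degree R v ≤ 3) (hCH : C ≤ H) (hC : IsCycle C)
    (h1 : {v ∈ V(C) | degree H v ≠ 2}.ncard ≤ 1) :
    {v ∈ V(C) | degree R v ≠ 2}.Subsingleton := by
  have hHR := hH.1.1.1
  by_cases hw : ∃ w ∈ V(C), degree H w ≠ 2
  · obtain ⟨w, hw, hdw⟩ := hw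
    have hrest : ∀ v ∈ V(C), v ≠ w → degree H v = 2 := fun v hv hvw => by
      by_contra hdv
      exact hvw ((Set.ncard_le_one (Set.toFinite _)).1 h1 v ⟨hv, hdv⟩ w ⟨hw, hdw⟩)
    have hw3 := (degree_mono ht hHR w).trans (hdeg w (hHR.vertexSet_mono (hCH.vertexSet_mono hw)))
    have hall : ∀ u ∈ V(C), u = w := fun u => hC.eq_of_degree_ne_two (ht.mono hHR) hH.1.1.2.1
      hH.1.1.2.2 hCH hw hw3 hdw hrest
    exact fun x hx y hy => (hall x hx.1).trans (hall y hy.1).symm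
  · push Not at hw
    rintro x ⟨hx, hdx⟩ y ⟨hy, hdy⟩
    exact hH.eq_of_degree_ne ht (hCH.vertexSet_mono hx) (hCH.vertexSet_mono hy)
      (by rwa [hw x hx]) (by rwa [hw y hy])

lemma IsLeafBlock.exists_isAttachedAt [Finite α] [Finite β] (ht : IsEndLabelling R t)
    (hH : IsLeafBlock R H) (hCH : C ≤ H) {y : α} (hy : y ∈ V(C)) (hCy : degree C y = 2)
    (hdH : degree H y = 2) (hdR : degree R y = 3) : ∃ A, IsAttachedAt t R C y A := by
  have hHR := hH.1.1.1
  have hyH := hCH.vertexSet_mono hy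
  obtain ⟨e, he, b, rfl⟩ := exists_edge_of_degree_ne ht hHR (v := y) (by omega)
  have hAH : ∀ v, Reach (R.deleteVerts {t e b}) (t e !b) v → v ∉ V(H) :=
    fun v => hH.1.notMem_of_reach (ht.isLink he.1 b) hyH he.2
  refine ⟨{v | Reach (R.deleteVerts {t e b}) (t e !b) v}, hy,
    Set.disjoint_left.2 fun v hv hvA => hAH v hvA (hCH.vertexSet_mono hv),
    fun f hf b' hfA => ?_, fun f hf b' hb' => ?_⟩
  · by_cases hfy : t f (!b') = t e b
    · exact Or.inr hfy
    · exact Or.inl (hfA.tail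
        (deleteVerts_adj.2 ⟨⟨f, ht.isLink hf b'⟩, fun h => hAH _ hfA (h ▸ hyH), hfy⟩))
  · have hadd := degree_add_ncard_halfEdgesAt_sdiff ht (hCH.trans hHR) (t e b)
    obtain ⟨p, hp⟩ := Set.ncard_eq_one.1
      (show (halfEdgesAt t (E(R) \ E(C)) (t e b)).ncard = 1 by omega)
    have hfp : (f, b') = p := hp.le ⟨hf, hb'⟩
    have hep : (e, b) = p := hp.le ⟨⟨he.1, fun h => he.2 (hCH.edgeSet_mono h)⟩, rfl⟩
    obtain ⟨rfl, rfl⟩ := Prod.mk.inj (hfp.trans hep.symm)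
    exact .refl

lemma IsHalfPreflowOff.extend_good_of_isLeafBlock [Finite α] [Finite β] {σ : β → ℤˣ} {S Z : Set β}
    {c : β × Bool → ZMod 3} (ht : IsEndLabelling R t) (hH : IsLeafBlock R H)
    (hdeg : ∀ v ∈ V(R), degree R v ≤ 3) (hCH : C ≤ H) (hc : IsHalfPreflowOff σ S Z t R C c)
    (hC : IsCycle C) (h2 : 2 ≤ {v ∈ V(C) | degree H v = 2}.ncard) (hZ : E(C) ⊆ Z)
    (hS : ∀ e ∈ E(C), e ∉ S) : ∃ f, IsHalfPreflow σ S Z t R f := by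
  have hHR := hH.1.1.1
  have hCR := hCH.trans hHR
  obtain ⟨x, ⟨hx, hdx⟩, y, ⟨hy, hdy⟩, hxy⟩ := (Set.one_lt_ncard (Set.toFinite _)).1 h2
  wlog hRx : degree R x = 2 generalizing x y
  · by_cases hRy : degree R y = 2
    · exact this y hy hdy x hxy.symm hx hdx hRy
    · exact absurd (hH.eq_of_degree_ne ht (hCH.vertexSet_mono hx) (hCH.vertexSet_mono hy)
        (by rwa [hdx]) (by rwa [hdy])) hxy
  by_cases hRy : degree R y = 2
  · exact hc.extend_cycle_of_two_le_ncard ht hCR hC hZ hS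
      ((Set.one_lt_ncard (Set.toFinite _)).2 ⟨x, ⟨hx, hRx⟩, y, ⟨hy, hRy⟩, hxy⟩)
  · have hRy3 : degree R y = 3 := by
      have h1 := degree_mono ht hHR y
      have h3 := hdeg y (hCR.vertexSet_mono hy)
      omega
    obtain ⟨A, hA⟩ := hH.exists_isAttachedAt ht hCH hy (hC.2 y hy) hdy hRy3
    exact hc.extend_cycle_of_isAttachedAt ht hCR hC hZ hS hx hxy hRx hRy3 hA

end Block

/-! ### Fish -/

section Path

variable {P K G : Graph α β} {t : β → Bool → α} {x y v : α}

lemma IsPath.degree_eq_one (hP : IsPath P x y) (hv : v ∈ ({x, y} : Set α)) : degree P v = 1 := by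
  obtain ⟨-, -, -, -, hx, hy, -⟩ := hP
  rcases hv with rfl | rfl
  exacts [hx, hy]

lemma IsPath.degree_eq_two (hP : IsPath P x y) (hv : v ∈ V(P)) (hxy : v ∉ ({x, y} : Set α)) :
    degree P v = 2 := by
  obtain ⟨-, -, -, -, -, -, h⟩ := hP
  exact h v hv (fun hx => hxy (Or.inl hx)) fun hy => hxy (Or.inr hy)

lemma IsPath.pair_subset (hP : IsPath P x y) : {x, y} ⊆ V(P) :=
  Set.pair_subset hP.2.1 hP.2.2.1

variable [Finite β]

lemma IsPath.odd_degree_iff (hP : IsPath P x y) (ht : IsEndLabelling P t) :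
    Odd (degree P v) ↔ v ∈ ({x, y} : Set α) := by
  refine ⟨fun h => ?_, fun h => hP.degree_eq_one h ▸ odd_one⟩
  by_contra hv
  by_cases hvP : v ∈ V(P)
  · rw [hP.degree_eq_two hvP hv] at h
    exact absurd h (by decide)
  · rw [degree_eq_zero_of_notMem ht hvP] at h
    exact absurd h (by decide)

variable [Finite α]

lemma IsPath.ncard_vertexSet (hP : IsPath P x y) (ht : IsEndLabelling P t) :
    V(P).ncard = E(P).ncard + 1 := by
  classical
  have hsum : ∀ v, degree P v + (if v ∈ ({x, y} : Set α) then 1 else 0) =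
      if v ∈ V(P) then 2 else 0 := fun v => by
    by_cases hv : v ∈ ({x, y} : Set α)
    · simp [hv, hP.pair_subset hv, hP.degree_eq_one hv]
    · by_cases hvP : v ∈ V(P)
      · simp [hv, hvP, hP.degree_eq_two hvP hv]
      · simp [hv, hvP, degree_eq_zero_of_notMem ht hvP]
  have hcount (X : Set α) [DecidablePred (· ∈ X)] (n : ℕ) :
      ∑ᶠ v, (if v ∈ X then n else 0) = X.ncard * n := by
    rw [← smul_eq_mul, ← finsum_mem_eq_nsmul_ncard (Set.toFinite _) fun _ _ => rfl]
    exact finsum_congr fun v => by rw [finsum_eq_if]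
  have h := finsum_congr hsum
  rw [finsum_add_distrib (Set.toFinite _) (Set.toFinite _), finsum_degree ht, hcount, hcount,
    Set.ncard_pair hP.2.2.2.1] at h
  lia

lemma IsPath.length_eq_one (hP : IsPath P x y) (ht : IsEndLabelling P t) {e : β} (he : e ∈ E(P))
    (hend : ∀ b, t e b ∈ ({x, y} : Set α)) : length P = 1 := by
  have hends : halfEdgesAt t E(P) x ∪ halfEdgesAt t E(P) y = {(e, false), (e, true)} := by
    refine (Set.eq_of_subset_of_ncard_le ?_ ?_).symm
    · rintro h (rfl | rfl)
      exacts [(hend false).imp (⟨he, ·⟩) (⟨he, ·⟩), (hend true).imp (⟨he, ·⟩) (⟨he, ·⟩)]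
    · refine (Set.ncard_union_le _ _).trans ?_
      rw [← degree_eq_ncard_halfEdgesAt ht, ← degree_eq_ncard_halfEdgesAt ht,
        hP.degree_eq_one (Or.inl rfl), hP.degree_eq_one (Or.inr rfl), Set.ncard_pair (by simp)]
  have hV : V(P) = {x, y} := by
    refine Set.Subset.antisymm (fun v hv => ?_) hP.pair_subset
    by_contra hvxy
    obtain ⟨e', he', hcross⟩ :=
      hP.1.crossingEdges_nonempty ht hP.2.1 hv (X := {x, y}) (Or.inl rfl) hvxy
    have heq : ∀ b, t e' b ∈ ({x, y} : Set α) → e' = e := fun b hb => by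
      have hmem : (e', b) ∈ ({(e, false), (e, true)} : Set (β × Bool)) :=
        hends ▸ hb.imp (⟨he', ·⟩) (⟨he', ·⟩)
      rcases hmem with h | h
      exacts [congrArg Prod.fst h, congrArg Prod.fst h]
    have hall : ∀ b b', t e' b ∈ ({x, y} : Set α) → t e' b' ∈ ({x, y} : Set α) :=
      fun b b' hb => heq b hb ▸ hend b'
    exact hcross ⟨hall _ _, hall _ _⟩
  have hcard := hP.ncard_vertexSet ht
  rw [hV, Set.ncard_pair hP.2.2.2.1] at hcard
  exact (Nat.succ_injective hcard).symm

lemma IsPath.disjoint_edgeSet (hP : IsPath P x y) (hP₁ : length P ≠ 1) (htP : IsEndLabelling P t)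
    (htK : IsEndLabelling K t) (hPK : V(P) ∩ V(K) ⊆ {x, y}) : Disjoint E(P) E(K) :=
  Set.disjoint_left.2 fun _ heP heK =>
    hP₁ (hP.length_eq_one htP heP fun b => hPK ⟨htP.mem heP b, htK.mem heK b⟩)

end Path

section Fish

variable [Finite β] {σ : β → ℤˣ} {S Z : Set β} {t : β → Bool → α} {R : Graph α β}

lemma halfEdgeSum_iUnion {ι A : Type*} [Fintype ι] [AddCommMonoid A] {F : ι → Set β}
    (hF : Pairwise fun i j => Disjoint (F i) (F j)) (c : β × Bool → A) {v : α} :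
    halfEdgeSum t (⋃ i, F i) c v = ∑ i, halfEdgeSum t (F i) c v := by
  have hunion : halfEdgesAt t (⋃ i, F i) v = ⋃ i, halfEdgesAt t (F i) v := by
    ext h
    simp [halfEdgesAt]
  rw [halfEdgeSum, hunion, finsum_mem_iUnion (fun i j hij => disjoint_halfEdgesAt (hF hij))
    fun _ => Set.toFinite _, finsum_eq_sum_of_fintype]
  rfl

lemma exists_isHalfPreflow_of_signs {ι : Type*} [Fintype ι] {F : ι → Set β} {s : ι → α → ℤˣ}
    (hF : Pairwise fun i j => Disjoint (F i) (F j)) (hFR : ∀ i, F i ⊆ E(R))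
    (hFZ : ∀ e ∈ E(R), (∀ i, e ∉ F i) → e ∈ Z) (hS : ∀ e ∈ E(R), e ∉ S)
    (hs : ∀ i, ∀ e ∈ F i, s i (t e false) * s i (t e true) = -σ e)
    (hfit : ∀ v ∈ V(R),
      FitsDegree (∑ i, (halfEdgesAt t (F i) v).ncard • sg (s i v)) (degree R v)) :
    ∃ c, IsHalfPreflow σ S Z t R c := by
  classical
  let c : β × Bool → ZMod 3 := fun h => ∑ i, if h.1 ∈ F i then sg (s i (t h.1 h.2)) else 0
  have hc_of_mem {i : ι} {e : β} (he : e ∈ F i) (b : Bool) : c (e, b) = sg (s i (t e b)) := by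
    refine (Finset.sum_eq_single i (fun j _ hj => if_neg fun hej => ?_) (by simp)).trans (if_pos he)
    exact Set.disjoint_left.1 (hF hj) hej he
  have hc_of_notMem {e : β} (he : ∀ i, e ∉ F i) (b : Bool) : c (e, b) = 0 :=
    Finset.sum_eq_zero fun i _ => if_neg (he i)
  refine ⟨c, fun e he => iff_of_false (not_not.2 ?_) (hS e he), fun e he b h0 => ?_,
    fun v hv => ?_⟩
  · by_cases h : ∃ i, e ∈ F i
    · obtain ⟨i, hi⟩ := h
      simpa only [edgeDefect, hc_of_mem hi] using edgeDefect_sg_eq_zero_iff.2 (hs i e hi)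
    · push Not at h
      simp only [edgeDefect, hc_of_notMem h, mul_zero, add_zero]
  · refine hFZ e he fun i hi => ?_
    rw [hc_of_mem hi] at h0
    exact sg_ne_zero _ h0
  · have hzero : halfEdgeSum t (E(R) \ ⋃ i, F i) c v = 0 :=
      finsum_mem_eq_zero_of_forall_eq_zero fun h hh =>
        hc_of_notMem (fun i hi => hh.1.2 (Set.mem_iUnion_of_mem i hi)) h.2
    have hpart (i : ι) : halfEdgeSum t (F i) c v = (halfEdgesAt t (F i) v).ncard • sg (s i v) :=
      halfEdgeSum_eq_nsmul fun h hh => by rw [hc_of_mem hh.1, hh.2]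
    rw [← Set.sdiff_union_of_subset (Set.iUnion_subset hFR),
      halfEdgeSum_union Set.disjoint_sdiff_left, hzero, zero_add, halfEdgeSum_iUnion hF]
    simpa only [hpart] using hfit v hv

end Fish

/-- The edges and vertices of a fish. The branches of its theta are the `p`-`q` paths `K 0`, `K 1`
and `K 2`, of which only `K 2` has length three. The ends of the middle edge `e₀` of `K 2` are
joined by the path `K 3`. -/
structure IsFishShape (R : Graph α β) (K : Fin 4 → Graph α β) (p q x y : α) (e₀ : β) : Prop where
  le : ∀ i, K i ≤ R
  vertexSet_eq : V(R) = ⋃ i, V(K i)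
  edgeSet_eq : E(R) = ⋃ i, E(K i)
  disjoint_edgeSet : Pairwise fun i j => Disjoint E(K i) E(K j)
  inter_subset : Pairwise fun i j => V(K i) ∩ V(K j) ⊆ {p, q} ∪ {x, y}
  isPath_branch : ∀ i ≠ 3, IsPath (K i) p q
  isPath_tail : IsPath (K 3) x y
  disjoint_branch : ∀ i ≠ 3, i ≠ 2 → Disjoint {x, y} V(K i)
  disjoint_tail : Disjoint {p, q} V(K 3)
  vertexSet_two : V(K 2) = {p, q} ∪ {x, y}
  isLink : (K 2).IsLink e₀ x y
  even_branch : ∀ i ≠ 3, Even (E(K i) \ {e₀}).ncard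
  odd_tail : Odd (E(K 3) \ {e₀}).ncard

lemma edgeCut_eq_crossingEdges {R : Graph α β} {t : β → Bool → α} (ht : IsEndLabelling R t)
    (X : Set α) : edgeCut R X = crossingEdges t E(R) X := by
  ext e
  constructor
  · rintro ⟨x, y, hl, hx, hy⟩
    refine ⟨hl.edge_mem, ?_⟩
    obtain ⟨_ | _, rfl, rfl⟩ := ht.exists_of_isLink hl
    exacts [fun h => hy (h.1 hx), fun h => hy (h.2 hx)]
  · rintro ⟨he, hcross⟩
    by_cases h : t e false ∈ X
    · exact ⟨_, _, ht.isLink he false, h, fun h' => hcross (iff_of_true h h')⟩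
    · exact ⟨_, _, ht.isLink he true, by_contra fun h' => hcross (iff_of_false h h'), h⟩

lemma ncard_halfEdgesAt_sdiff_singleton {t : β → Bool → α} {F : Set β} {e : β} {b : Bool}
    (he : e ∈ F) (hne : t e (!b) ≠ t e b) :
    (halfEdgesAt t (F \ {e}) (t e b)).ncard = (halfEdgesAt t F (t e b)).ncard - 1 := by
  have hmem : (e, b) ∈ halfEdgesAt t F (t e b) := ⟨he, rfl⟩
  rw [← Set.ncard_sdiff_singleton_of_mem hmem]
  congr 1
  ext ⟨e', b'⟩
  simp only [halfEdgesAt, Set.mem_ofPred_eq, Set.mem_sdiff, Set.mem_singleton_iff, Prod.mk.injEq]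
  by_cases heq : e' = e
  · subst heq
    cases b <;> cases b' <;> simp_all
  · simp [heq]

lemma degree_eq_sum_of_edgeSet_eq_iUnion [Finite β] {ι : Type*} [Fintype ι] {R : Graph α β}
    {K : ι → Graph α β} {t : β → Bool → α} (ht : IsEndLabelling R t) (hle : ∀ i, K i ≤ R)
    (hE : E(R) = ⋃ i, E(K i)) (hdisj : Pairwise fun i j => Disjoint E(K i) E(K j)) (v : α) :
    degree R v = ∑ i, degree (K i) v := by
  have hcount (F : Set β) : (halfEdgesAt t F v).ncard = halfEdgeSum t F (fun _ => 1) v := by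
    rw [halfEdgeSum_eq_nsmul fun _ _ => rfl, smul_eq_mul, mul_one]
  rw [degree_eq_ncard_halfEdgesAt ht, hE, hcount, halfEdgeSum_iUnion hdisj]
  simp only [degree_eq_ncard_halfEdgesAt (ht.mono (hle _)), hcount]

namespace IsFishShape

variable {σ : β → ℤˣ} {S Z : Set β} {t : β → Bool → α} {R : Graph α β} {K : Fin 4 → Graph α β}
  {p q x y v : α} {e₀ : β}

lemma notMem_pair (h : IsFishShape R K p q x y e₀) (hv : v ∈ ({x, y} : Set α)) :
    v ∉ ({p, q} : Set α) := fun hpq =>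
  Set.disjoint_left.1 (h.disjoint_branch 0 (by decide) (by decide)) hv
    ((h.isPath_branch 0 (by decide)).pair_subset hpq)

lemma mem_edgeSet_iff (h : IsFishShape R K p q x y e₀) {i : Fin 4} : e₀ ∈ E(K i) ↔ i = 2 := by
  refine ⟨fun hi => ?_, fun hi => hi ▸ h.isLink.edge_mem⟩
  by_contra hne
  exact Set.disjoint_left.1 (h.disjoint_edgeSet hne) hi h.isLink.edge_mem

lemma crossingEdges_tail_nonempty (h : IsFishShape R K p q x y e₀) (ht : IsEndLabelling R t)
    {X : Set α} (he₀ : ¬ (t e₀ false ∈ X ↔ t e₀ true ∈ X)) :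
    (crossingEdges t E(K 3) X).Nonempty := by
  have hxy : x ∈ X ∧ y ∉ X ∨ y ∈ X ∧ x ∉ X := by
    obtain ⟨_ | _, rfl, rfl⟩ := (ht.mono (h.le 2)).exists_of_isLink h.isLink <;> grind
  have htK := ht.mono (h.le 3)
  have hends := h.isPath_tail.pair_subset
  rcases hxy with ⟨hx, hy⟩ | ⟨hy, hx⟩
  exacts [h.isPath_tail.1.crossingEdges_nonempty htK (hends (.inl rfl)) (hends (.inr rfl)) hx hy,
    h.isPath_tail.1.crossingEdges_nonempty htK (hends (.inr rfl)) (hends (.inl rfl)) hy hx]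

variable [Finite β]

lemma degree_of_mem_pq (h : IsFishShape R K p q x y e₀) (ht : IsEndLabelling R t)
    (hv : v ∈ ({p, q} : Set α)) (i : Fin 4) : degree (K i) v = ![1, 1, 1, 0] i := by
  fin_cases i
  exacts [(h.isPath_branch 0 (by decide)).degree_eq_one hv,
    (h.isPath_branch 1 (by decide)).degree_eq_one hv,
    (h.isPath_branch 2 (by decide)).degree_eq_one hv,
    degree_eq_zero_of_notMem (ht.mono (h.le 3)) (Set.disjoint_left.1 h.disjoint_tail hv)]

lemma degree_of_mem_xy (h : IsFishShape R K p q x y e₀) (ht : IsEndLabelling R t)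
    (hv : v ∈ ({x, y} : Set α)) (i : Fin 4) : degree (K i) v = ![0, 0, 2, 1] i := by
  fin_cases i
  exacts [degree_eq_zero_of_notMem (ht.mono (h.le 0))
      (Set.disjoint_left.1 (h.disjoint_branch 0 (by decide) (by decide)) hv),
    degree_eq_zero_of_notMem (ht.mono (h.le 1))
      (Set.disjoint_left.1 (h.disjoint_branch 1 (by decide) (by decide)) hv),
    (h.isPath_branch 2 (by decide)).degree_eq_two (h.vertexSet_two ▸ Or.inr hv) (h.notMem_pair hv),
    h.isPath_tail.degree_eq_one hv]

lemma exists_degree_eq_single (h : IsFishShape R K p q x y e₀) (ht : IsEndLabelling R t)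
    (hvR : v ∈ V(R)) (hpq : v ∉ ({p, q} : Set α)) (hxy : v ∉ ({x, y} : Set α)) :
    ∃ j, ∀ i, degree (K i) v = if i = j then 2 else 0 := by
  rw [h.vertexSet_eq] at hvR
  obtain ⟨j, hj⟩ := Set.mem_iUnion.1 hvR
  refine ⟨j, fun i => ?_⟩
  split_ifs with hij
  · rw [hij]
    by_cases hj3 : j = 3
    · exact (hj3 ▸ h.isPath_tail).degree_eq_two (hj3 ▸ hj) hxy
    · exact (h.isPath_branch j hj3).degree_eq_two hj hpq
  · exact degree_eq_zero_of_notMem (ht.mono (h.le i)) fun hi =>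
      (h.inter_subset hij ⟨hi, hj⟩).elim hpq hxy

lemma degree_eq_sum (h : IsFishShape R K p q x y e₀) (ht : IsEndLabelling R t) (v : α) :
    degree R v = ∑ i, degree (K i) v :=
  degree_eq_sum_of_edgeSet_eq_iUnion ht h.le h.edgeSet_eq h.disjoint_edgeSet v

lemma ncard_halfEdgesAt_part (h : IsFishShape R K p q x y e₀) (ht : IsEndLabelling R t)
    (hv : v ∉ ({x, y} : Set α)) (i : Fin 4) :
    (halfEdgesAt t (E(K i) \ {e₀}) v).ncard = degree (K i) v := by
  rw [degree_eq_ncard_halfEdgesAt (ht.mono (h.le i))]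
  congr 1
  refine Set.Subset.antisymm (fun _ hh => ⟨hh.1.1, hh.2⟩) fun ⟨e, b⟩ hh => ⟨⟨hh.1, ?_⟩, hh.2⟩
  rintro rfl
  refine hv ?_
  rw [← hh.2]
  exact ((ht.mono (h.le 2)).isLink h.isLink.edge_mem b).inc_left.eq_or_eq_of_isLink h.isLink

lemma ncard_halfEdgesAt_part_of_mem_xy (h : IsFishShape R K p q x y e₀) (ht : IsEndLabelling R t)
    (hv : v ∈ ({x, y} : Set α)) (i : Fin 4) :
    (halfEdgesAt t (E(K i) \ {e₀}) v).ncard = ![0, 0, 1, 1] i := by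
  by_cases hi : i = 2
  · subst hi
    obtain ⟨b, rfl, hne⟩ : ∃ b, t e₀ b = v ∧ t e₀ (!b) ≠ v := by
      have hxy : x ≠ y := h.isPath_tail.2.2.2.1
      obtain ⟨b, hx, hy⟩ := (ht.mono (h.le 2)).exists_of_isLink h.isLink
      rcases hv with rfl | rfl
      exacts [⟨b, hx, hy ▸ hxy.symm⟩, ⟨!b, hy, by rwa [Bool.not_not, hx]⟩]
    rw [ncard_halfEdgesAt_sdiff_singleton h.isLink.edge_mem hne,
      ← degree_eq_ncard_halfEdgesAt (ht.mono (h.le 2)), h.degree_of_mem_xy ht hv]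
    rfl
  · rw [Set.sdiff_singleton_eq_self (h.mem_edgeSet_iff.not.2 hi),
      ← degree_eq_ncard_halfEdgesAt (ht.mono (h.le i)), h.degree_of_mem_xy ht hv]
    fin_cases i <;> simp_all

lemma fitsDegree (h : IsFishShape R K p q x y e₀) (ht : IsEndLabelling R t) {u : α → ℤˣ}
    {s : Fin 4 → α → ℤˣ} (hs_branch : ∀ i ≠ 3, ∀ v ∈ ({p, q} : Set α), s i v = u v)
    (hs_two : ∀ v ∈ ({x, y} : Set α), s 2 v = -u v)
    (hs_tail : ∀ v ∈ ({x, y} : Set α), s 3 v = u v) (hv : v ∈ V(R)) :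
    FitsDegree (∑ i, (halfEdgesAt t (E(K i) \ {e₀}) v).ncard • sg (s i v)) (degree R v) := by
  rw [h.degree_eq_sum ht]
  by_cases hxy : v ∈ ({x, y} : Set α)
  · simp only [h.ncard_halfEdgesAt_part_of_mem_xy ht hxy, h.degree_of_mem_xy ht hxy,
      Fin.sum_univ_four]
    simp [FitsDegree, hs_two v hxy, hs_tail v hxy, sg_neg]
  simp only [h.ncard_halfEdgesAt_part ht hxy]
  by_cases hpq : v ∈ ({p, q} : Set α)
  · simp only [h.degree_of_mem_pq ht hpq, Fin.sum_univ_four]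
    have htriple : ∀ z : ZMod 3, z + z + z = 0 := by decide
    simp [FitsDegree, hs_branch _ _ v hpq, htriple]
  · obtain ⟨j, hj⟩ := h.exists_degree_eq_single ht hv hpq hxy
    have htwo : ∀ a : ℤˣ, 2 • sg a ≠ 0 := by decide
    simpa [FitsDegree, hj, ite_smul] using htwo (s j v)

lemma even_ncard_halfEdgesAt (h : IsFishShape R K p q x y e₀) (ht : IsEndLabelling R t) (v : α) :
    Even (halfEdgesAt t (E(K 0) ∪ E(K 2)) v).ncard := by
  rw [halfEdgesAt_union, Set.ncard_union_eq (disjoint_halfEdgesAt (h.disjoint_edgeSet (by decide))),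
    ← degree_eq_ncard_halfEdgesAt (ht.mono (h.le 0)),
    ← degree_eq_ncard_halfEdgesAt (ht.mono (h.le 2)), Nat.even_add',
    (h.isPath_branch 0 (by decide)).odd_degree_iff (ht.mono (h.le 0)),
    (h.isPath_branch 2 (by decide)).odd_degree_iff (ht.mono (h.le 2))]

/-- The cycle `K 0 ∪ K 2` meets every edge cut in an even number of edges, and the path `K 3` meets
every edge cut that separates the ends of `e₀`. -/
lemma isDistinguishedEdge [Finite α] (h : IsFishShape R K p q x y e₀) (ht : IsEndLabelling R t) :
    IsDistinguishedEdge R e₀ := by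
  refine ⟨(h.le 2).edgeSet_mono h.isLink.edge_mem, fun X hX heX => ?_⟩
  rw [edgeCut_eq_crossingEdges ht] at hX heX
  have hcycle : 2 ≤ (crossingEdges t (E(K 0) ∪ E(K 2)) X).ncard := by
    have heven : Even (crossingEdges t (E(K 0) ∪ E(K 2)) X).ncard :=
      even_ncard_crossingEdges fun v _ => h.even_ncard_halfEdgesAt ht v
    have hpos : 0 < (crossingEdges t (E(K 0) ∪ E(K 2)) X).ncard :=
      (Set.ncard_pos (Set.toFinite _)).2 ⟨e₀, Or.inr h.isLink.edge_mem, heX.2⟩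
    obtain ⟨k, hk⟩ := heven
    lia
  have htail : 0 < (crossingEdges t E(K 3) X).ncard :=
    (Set.ncard_pos (Set.toFinite _)).2 (h.crossingEdges_tail_nonempty ht heX.2)
  have hdisj : Disjoint (E(K 0) ∪ E(K 2)) E(K 3) :=
    Set.disjoint_union_left.2
      ⟨h.disjoint_edgeSet (by decide), h.disjoint_edgeSet (by decide)⟩
  have hle : (crossingEdges t (E(K 0) ∪ E(K 2)) X ∪ crossingEdges t E(K 3) X).ncard ≤ 2 := by
    rw [← hX]
    refine Set.ncard_le_ncard ?_ (Set.toFinite _)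
    rintro e (⟨he | he, hc⟩ | ⟨he, hc⟩)
    exacts [⟨(h.le _).edgeSet_mono he, hc⟩, ⟨(h.le _).edgeSet_mono he, hc⟩,
      ⟨(h.le _).edgeSet_mono he, hc⟩]
  rw [Set.ncard_union_eq
    (Set.disjoint_left.2 fun _ h₁ h₂ => Set.disjoint_left.1 hdisj h₁.1 h₂.1)] at hle
  lia

end IsFishShape

lemma IsPotential.const_mul {σ : β → ℤˣ} {K : Graph α β} {s : α → ℤˣ} (hs : IsPotential σ K s)
    (a : ℤˣ) : IsPotential σ K fun v => a * s v := fun e x y he => by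
  rw [mul_mul_mul_comm, Int.units_mul_self, one_mul, hs e x y he]

lemma IsPath.exists_isPotential_eq [Finite α] [Finite β] {σ : β → ℤˣ} {P : Graph α β}
    {t : β → Bool → α} {x y : α} {u : α → ℤˣ} (hP : IsPath P x y) (ht : IsEndLabelling P t)
    (hu : u x * u y = sign σ P) :
    ∃ s, IsPotential σ P s ∧ ∀ v ∈ ({x, y} : Set α), s v = u v := by
  obtain ⟨s, hs⟩ := hP.exists_isPotential ht σ
  refine ⟨_, hs.const_mul (u x * s x), ?_⟩
  rw [hs.sign_eq_mul hP ht] at hu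
  rintro v (rfl | rfl)
  · simp only [mul_assoc, Int.units_mul_self, mul_one]
  · simp only [mul_assoc, ← hu]
    rw [← mul_assoc, Int.units_mul_self, one_mul]

namespace IsFishShape

variable {σ : β → ℤˣ} {S Z : Set β} {t : β → Bool → α} {R : Graph α β} {K : Fin 4 → Graph α β}
  {p q x y : α} {e₀ : β} {u : α → ℤˣ}

lemma inter_tail_subset (h : IsFishShape R K p q x y e₀) {i : Fin 4} (hi : i ≠ 3) :
    V(K i) ∩ V(K 3) ⊆ {x, y} := fun _ hv =>
  (h.inter_subset hi hv).resolve_left fun hpq => Set.disjoint_left.1 h.disjoint_tail hpq hv.2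

lemma exists_mem_edgeSet (h : IsFishShape R K p q x y e₀) {e : β} (he : e ∈ E(R)) :
    ∃ i, e ∈ E(K i) := by
  rwa [h.edgeSet_eq, Set.mem_iUnion] at he

variable [Finite β]

/-- In comparison with `u`, a potential of the signature negated off `e₀` changes sign along every
edge of `K 2` but `e₀`. -/
lemma eq_neg_of_isPotential [DecidablePred (· ∈ ({e₀} : Set β))] (h : IsFishShape R K p q x y e₀)
    (ht : IsEndLabelling R t) (hu : IsPotential σ (K 2) u) {s : α → ℤˣ}
    (hs : IsPotential (fun e => if e ∈ ({e₀} : Set β) then σ e else -σ e) (K 2) s)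
    (hsu : ∀ v ∈ ({p, q} : Set α), s v = u v) : ∀ v ∈ ({x, y} : Set α), s v = -u v := by
  have htK := ht.mono (h.le 2)
  have hflip {e : β} {v w : α} (he : (K 2).IsLink e v w) (hne : e ∉ ({e₀} : Set β)) :
      s v = u v ↔ s w = -u w := by
    have h₁ : s v * s w = -(u v * u w) := by
      rw [hu e v w he]
      exact (hs e v w he).trans (if_neg hne)
    generalize s v = a, s w = b, u v = c, u w = d at *
    revert a b c d
    decide
  have hkeep : s x = -u x ↔ s y = -u y := by
    have h₁ : s x * s y = u x * u y := by
      rw [hu e₀ x y h.isLink]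
      exact (hs e₀ x y h.isLink).trans (if_pos rfl)
    generalize s x = a, s y = b, u x = c, u y = d at *
    revert a b c d
    decide
  obtain ⟨⟨e, b⟩, he, hp⟩ : (halfEdgesAt t E(K 2) p).Nonempty := by
    rw [← Set.ncard_pos (Set.toFinite _), ← degree_eq_ncard_halfEdgesAt htK,
      h.degree_of_mem_pq ht (Or.inl rfl)]
    exact one_pos
  have hlink : (K 2).IsLink e p (t e !b) := hp ▸ htK.isLink he b
  have hne : e ∉ ({e₀} : Set β) := by
    rintro rfl
    exact h.notMem_pair (hlink.inc_left.eq_or_eq_of_isLink h.isLink) (Or.inl rfl)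
  have hz : s (t e !b) = -u (t e !b) := (hflip hlink hne).1 (hsu p (Or.inl rfl))
  rcases h.vertexSet_two ▸ hlink.right_mem with hpq | hxy
  · exact absurd ((hsu _ hpq).symm.trans hz) (units_ne_neg_self _)
  · have hx : s x = -u x := by
      rcases hxy with hx | hy
      exacts [hx ▸ hz, hkeep.2 (hy ▸ hz)]
    rintro v (rfl | rfl)
    exacts [hx, hkeep.1 hx]

variable [Finite α]

lemma sign_tail (h : IsFishShape R K p q x y e₀) (ht : IsEndLabelling R t)
    (hu : ∀ i ≠ 3, IsPotential σ (K i) u) (hR : ¬ Balanced σ R) :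
    sign σ (K 3) = -(u x * u y) := by
  classical
  refine Int.units_ne_iff_eq_neg.1 fun hsign => hR (balanced_iff_exists_isPotential.2 ?_)
  obtain ⟨s, hs, hsu⟩ := h.isPath_tail.exists_isPotential_eq (ht.mono (h.le 3)) hsign.symm
  let w : α → ℤˣ := fun v => if v ∈ V(K 3) then s v else u v
  refine ⟨w, (isPotential_iff ht).2 fun e he => ?_⟩
  obtain ⟨i, hei⟩ := h.exists_mem_edgeSet he
  have hti := ht.mono (h.le i)
  by_cases hi : i = 3
  · subst hi
    have hw (b : Bool) : w (t e b) = s (t e b) := if_pos (hti.mem hei b)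
    rw [hw, hw, hs e _ _ (hti e hei)]
  · have hw (b : Bool) : w (t e b) = u (t e b) := by
      by_cases hb : t e b ∈ V(K 3)
      exacts [(if_pos hb).trans (hsu _ (h.inter_tail_subset hi ⟨hti.mem hei b, hb⟩)), if_neg hb]
    rw [hw, hw, hu i hi e _ _ (hti e hei)]

lemma exists_twisted_potentials [DecidablePred (· ∈ ({e₀} : Set β))]
    (h : IsFishShape R K p q x y e₀) (ht : IsEndLabelling R t)
    (hu : ∀ i ≠ 3, IsPotential σ (K i) u) (hR : ¬ Balanced σ R) :
    ∃ s : Fin 4 → α → ℤˣ,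
      (∀ i, IsPotential (fun e => if e ∈ ({e₀} : Set β) then σ e else -σ e) (K i) (s i)) ∧
      (∀ i ≠ 3, ∀ v ∈ ({p, q} : Set α), s i v = u v) ∧ ∀ v ∈ ({x, y} : Set α), s 3 v = u v := by
  have hpart : ∀ i, ∃ s : α → ℤˣ,
      IsPotential (fun e => if e ∈ ({e₀} : Set β) then σ e else -σ e) (K i) s ∧
      (i ≠ 3 → ∀ v ∈ ({p, q} : Set α), s v = u v) ∧
      (i = 3 → ∀ v ∈ ({x, y} : Set α), s v = u v) := fun i => by
    by_cases hi : i = 3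
    · subst hi
      obtain ⟨s, hs, hsu⟩ := h.isPath_tail.exists_isPotential_eq (ht.mono (h.le 3)) <| by
        rw [sign_twist σ {e₀}, h.odd_tail.neg_one_pow, h.sign_tail ht hu hR, neg_mul_neg, one_mul]
      exact ⟨s, hs, fun hne => (hne rfl).elim, fun _ => hsu⟩
    · have hP := h.isPath_branch i hi
      obtain ⟨s, hs, hsu⟩ := hP.exists_isPotential_eq (ht.mono (h.le i)) <| by
        rw [sign_twist σ {e₀}, (h.even_branch i hi).neg_one_pow, one_mul,
          (hu i hi).sign_eq_mul hP (ht.mono (h.le i))]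
      exact ⟨s, hs, fun _ => hsu, fun heq => (hi heq).elim⟩
  choose s hs hpq hxy using hpart
  exact ⟨s, hs, hpq, hxy 3 rfl⟩

theorem exists_isHalfPreflow (h : IsFishShape R K p q x y e₀) (ht : IsEndLabelling R t)
    (hu : ∀ i ≠ 3, IsPotential σ (K i) u) (hR : ¬ Balanced σ R) (hS : ∀ e ∈ E(R), e ∉ S)
    (he₀ : e₀ ∈ Z) : ∃ c, IsHalfPreflow σ S Z t R c := by
  classical
  obtain ⟨s, hs, hpq, hxy⟩ := h.exists_twisted_potentials ht hu hR
  have hxy₂ := h.eq_neg_of_isPotential ht (hu 2 (by decide)) (hs 2) (hpq 2 (by decide))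
  refine exists_isHalfPreflow_of_signs (F := fun i => E(K i) \ {e₀})
    (fun i j hij => (h.disjoint_edgeSet hij).mono Set.sdiff_subset Set.sdiff_subset)
    (fun i => Set.sdiff_subset.trans (h.le i).edgeSet_mono) (fun e he hei => ?_) hS
    (fun i e he => ?_) fun v hv => h.fitsDegree ht hpq hxy₂ hxy hv
  · obtain ⟨i, hi⟩ := h.exists_mem_edgeSet he
    have heq : e = e₀ := by_contra fun hne => hei i ⟨hi, hne⟩
    exact heq ▸ he₀
  · exact (hs i e _ _ (ht.mono (h.le i) e he.1)).trans (if_neg he.2)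

end IsFishShape

lemma pairwise_of_castSucc {γ : Type*} {n : ℕ} {f : Fin (n + 1) → γ} {r : γ → γ → Prop}
    (hr : ∀ a b, r a b → r b a) (h : Pairwise fun i j : Fin n => r (f i.castSucc) (f j.castSucc))
    (hlast : ∀ i : Fin n, r (f (Fin.last n)) (f i.castSucc)) : Pairwise fun i j => r (f i) (f j) :=
  Fin.forall_fin_succ'.2
    ⟨fun i => Fin.forall_fin_succ'.2
      ⟨fun _ hij => h fun hi => hij (congrArg _ hi), fun _ => hr _ _ (hlast i)⟩,
    Fin.forall_fin_succ'.2 ⟨fun i _ => hlast i, fun hne => (hne rfl).elim⟩⟩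

lemma pairwise_fin_three {γ : Type*} {f : Fin 3 → γ} {r : γ → γ → Prop}
    (hr : ∀ a b, r a b → r b a) (h₀₁ : r (f 0) (f 1)) (h₀₂ : r (f 0) (f 2)) (h₁₂ : r (f 1) (f 2)) :
    Pairwise fun i j => r (f i) (f j) :=
  pairwise_of_castSucc hr (pairwise_of_castSucc (n := 1) (f := fun i => f i.castSucc) hr
    (fun _ _ hij => (hij (Subsingleton.elim _ _)).elim) (Fin.forall_fin_one.2 (hr _ _ h₀₁)))
    (Fin.forall_fin_two.2 ⟨hr _ _ h₀₂, hr _ _ h₁₂⟩)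

/-- The theta of a fish: a theta with branching vertices `p` and `q` and with branches `B 0`, `B 1`
and `B 2`, of which only `B 2` has length three. -/
structure IsThetaShape (H : Graph α β) (B : Fin 3 → Graph α β) (p q : α) : Prop where
  le : ∀ i, B i ≤ H
  vertexSet_eq : V(H) = ⋃ i, V(B i)
  edgeSet_eq : E(H) = ⋃ i, E(B i)
  isPath : ∀ i, IsPath (B i) p q
  length_eq : ∀ i, length (B i) = if i = 2 then 3 else 2
  inter_subset : Pairwise fun i j => V(B i) ∩ V(B j) ⊆ {p, q}

namespace IsThetaShape

variable {σ τ : β → ℤˣ} {S Z : Set β} {t : β → Bool → α} {R H P : Graph α β}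
  {B : Fin 3 → Graph α β} {K : Fin 4 → Graph α β} {p q x y : α}

lemma disjoint_pair_vertexSet (h : IsThetaShape H B p q)
    (hne : Disjoint ({x, y} : Set α) {p, q}) (hV₂ : V(B 2) = {p, q} ∪ {x, y}) {i : Fin 3}
    (hi : i ≠ 2) : Disjoint ({x, y} : Set α) V(B i) :=
  Set.disjoint_left.2 fun _ hxy hvi =>
    Set.disjoint_left.1 hne hxy (h.inter_subset hi ⟨hvi, hV₂ ▸ Or.inr hxy⟩)

variable [Finite α] [Finite β]

lemma disjoint_edgeSet (h : IsThetaShape H B p q) (ht : IsEndLabelling H t) :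
    Pairwise fun i j => Disjoint E(B i) E(B j) := fun i _ hij =>
  (h.isPath i).disjoint_edgeSet (by rw [h.length_eq]; split_ifs <;> decide) (ht.mono (h.le _))
    (ht.mono (h.le _)) (h.inter_subset hij)

lemma disjoint_pair (h : IsThetaShape H B p q) (ht : IsEndLabelling H t)
    (hdeg : ∀ v ∈ ({x, y} : Set α), degree H v = 2) : Disjoint ({x, y} : Set α) {p, q} :=
  Set.disjoint_left.2 fun v hv hpq => by
    have hsum := degree_eq_sum_of_edgeSet_eq_iUnion ht h.le h.edgeSet_eq (h.disjoint_edgeSet ht) v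
    simp only [hdeg v hv, (h.isPath _).degree_eq_one hpq] at hsum
    exact absurd hsum (by decide)

lemma ncard_edgeSet_sdiff (h : IsThetaShape H B p q) (ht : IsEndLabelling H t) {e : β}
    (he : e ∈ E(B 2)) (i : Fin 3) : (E(B i) \ {e}).ncard = 2 := by
  by_cases hi : i = 2
  · subst hi
    rw [Set.ncard_sdiff_singleton_of_mem he, ← length, h.length_eq, if_pos rfl]
  · have hei : e ∉ E(B i) := fun hei => Set.disjoint_left.1 (h.disjoint_edgeSet ht hi) hei he
    rw [Set.sdiff_singleton_eq_self hei, ← length, h.length_eq, if_neg hi]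

/-- Only the longest branch has enough vertices to contain `p`, `q`, `x` and `y`. -/
lemma exists_isLink_two (h : IsThetaShape H B p q) (ht : IsEndLabelling H t)
    (hne : Disjoint ({x, y} : Set α) {p, q}) (hxy : x ≠ y) (hadj : H.Adj x y) :
    ∃ e, (B 2).IsLink e x y ∧ V(B 2) = {p, q} ∪ {x, y} := by
  obtain ⟨e, he⟩ := hadj
  obtain ⟨i, hi⟩ := Set.mem_iUnion.1 (h.edgeSet_eq ▸ he.edge_mem)
  have hei : (B i).IsLink e x y := ((h.le i).isLink_iff hi).2 he
  have hsub : {p, q} ∪ {x, y} ⊆ V(B i) :=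
    Set.union_subset (h.isPath i).pair_subset (Set.pair_subset hei.left_mem hei.right_mem)
  have hcard : ({p, q} ∪ {x, y} : Set α).ncard = 4 := by
    rw [Set.ncard_union_eq hne.symm, Set.ncard_pair (h.isPath i).2.2.2.1, Set.ncard_pair hxy]
  have hV : V(B i).ncard = (if i = 2 then 3 else 2) + 1 :=
    h.length_eq i ▸ (h.isPath i).ncard_vertexSet (ht.mono (h.le i))
  have hle := Set.ncard_le_ncard hsub
  rw [hcard, hV] at hle
  obtain rfl : i = 2 := by
    by_contra h2
    rw [if_neg h2] at hle
    exact absurd hle (by decide)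
  exact ⟨e, hei, (Set.eq_of_subset_of_ncard_le hsub (by rw [hcard, hV, if_pos rfl])).symm⟩

theorem exists_isFishShape (h : IsThetaShape H (fun i => K i.castSucc) p q)
    (ht : IsEndLabelling R t) (hH : H ≤ R) (hK : K 3 ≤ R) (hV : V(R) = V(H) ∪ V(K 3))
    (hE : E(R) = E(H) ∪ E(K 3)) (hP : IsPath (K 3) x y) (hodd : Odd (length (K 3)))
    (hP₁ : length (K 3) ≠ 1) (hPH : V(K 3) ∩ V(H) = {x, y})
    (hdeg : ∀ v ∈ ({x, y} : Set α), degree H v = 2) (hadj : H.Adj x y) :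
    ∃ e, IsFishShape R K p q x y e := by
  have hbranch (i : Fin 4) (hi : i ≠ 3) : ∃ j : Fin 3, j.castSucc = i := Fin.exists_castSucc_eq.2 hi
  have hne := h.disjoint_pair (ht.mono hH) hdeg
  obtain ⟨e, he, hV₂⟩ := h.exists_isLink_two (ht.mono hH) hne hP.2.2.2.1 hadj
  have htail (i : Fin 3) : V(K 3) ∩ V(K i.castSucc) ⊆ {x, y} := fun v hv =>
    hPH.subset ⟨hv.1, (h.le i).vertexSet_mono hv.2⟩
  have hdisj (i : Fin 3) : Disjoint E(K 3) E(K i.castSucc) :=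
    hP.disjoint_edgeSet hP₁ (ht.mono hK) (ht.mono ((h.le i).trans hH)) (htail i)
  refine ⟨e, {
    le := Fin.forall_fin_succ'.2 ⟨fun i => (h.le i).trans hH, hK⟩
    vertexSet_eq := ?_
    edgeSet_eq := ?_
    disjoint_edgeSet :=
      pairwise_of_castSucc (fun _ _ hr => hr.symm) (h.disjoint_edgeSet (ht.mono hH)) hdisj
    inter_subset := pairwise_of_castSucc (r := fun K K' => V(K) ∩ V(K') ⊆ {p, q} ∪ {x, y})
      (fun _ _ hr => (Set.inter_comm _ _).trans_subset hr)
      (fun i j hij => (h.inter_subset hij).trans Set.subset_union_left)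
      fun i => (htail i).trans Set.subset_union_right
    isPath_branch := fun i hi => ?_
    isPath_tail := hP
    disjoint_branch := fun i hi hi₂ => ?_
    disjoint_tail := Set.disjoint_left.2 fun v hpq hv =>
      Set.disjoint_left.1 hne (htail 2 ⟨hv, (h.isPath 2).pair_subset hpq⟩) hpq
    vertexSet_two := hV₂
    isLink := he
    even_branch := fun i hi => ?_
    odd_tail := ?_ }⟩
  · ext v
    simp [hV, h.vertexSet_eq, Fin.exists_fin_succ' (n := 3)]
  · ext v
    simp [hE, h.edgeSet_eq, Fin.exists_fin_succ' (n := 3)]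
  · obtain ⟨j, rfl⟩ := hbranch i hi
    exact h.isPath j
  · obtain ⟨j, rfl⟩ := hbranch i hi
    exact h.disjoint_pair_vertexSet hne hV₂ fun hj => hi₂ (hj ▸ rfl)
  · obtain ⟨j, rfl⟩ := hbranch i hi
    exact (h.ncard_edgeSet_sdiff (ht.mono hH) he.edge_mem j).symm ▸ even_two
  · rwa [Set.sdiff_singleton_eq_self fun h₃ => Set.disjoint_left.1 (hdisj 2) h₃ he.edge_mem]

end IsThetaShape

theorem exists_isHalfPreflow_of_isFish [Finite α] [Finite β] {R : Graph α β} {t : β → Bool → α}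
    {σ τ : β → ℤˣ} {S Z : Set β} (ht : IsEndLabelling R t) (hsw : SwitchEquivalent R σ τ)
    (hfish : IsFish τ R) (hS : ∀ e ∈ E(R), e ∉ S) (hZ : ∀ e, IsDistinguishedEdge R e → e ∈ Z) :
    ∃ c, IsHalfPreflow σ S Z t R c := by
  obtain ⟨H, hH, P, hP, ⟨p, q, B₁, hB₁, B₂, hB₂, B₃, hB₃, h₁, h₂, h₃, l₁, l₂, l₃, i₁₂, i₁₃, i₂₃,
    hV, hE⟩, ⟨x, y, hxy, lodd, lP, hPH, hdx, hdy, hadj⟩, hVR, hER, hbal, hunb⟩ := hfish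
  have htheta : IsThetaShape H (fun i => ![B₁, B₂, B₃, P] i.castSucc) p q := {
    le := Fin.forall_fin_succ.2 ⟨hB₁, Fin.forall_fin_two.2 ⟨hB₂, hB₃⟩⟩
    vertexSet_eq := by
      ext v
      simp [hV, Fin.exists_fin_succ, or_assoc]
    edgeSet_eq := by
      ext e
      simp [hE, Fin.exists_fin_succ, or_assoc]
    isPath := Fin.forall_fin_succ.2 ⟨h₁, Fin.forall_fin_two.2 ⟨h₂, h₃⟩⟩
    length_eq := Fin.forall_fin_succ.2 ⟨l₁, Fin.forall_fin_two.2 ⟨l₂, l₃⟩⟩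
    inter_subset := pairwise_fin_three (r := fun K K' => V(K) ∩ V(K') ⊆ {p, q})
      (fun _ _ hr => (Set.inter_comm _ _).trans_subset hr) i₁₂.subset i₁₃.subset i₂₃.subset }
  obtain ⟨e, hshape⟩ := htheta.exists_isFishShape ht hH hP hVR hER hxy lodd
    ((by decide : 1 < 3).trans_le lP).ne' hPH (by rintro v (rfl | rfl); exacts [hdx, hdy]) hadj
  have hK : ∀ i ≠ 3, ![B₁, B₂, B₃, P] i ≤ H := fun i hi => by
    obtain ⟨j, rfl⟩ : ∃ j : Fin 3, j.castSucc = i := Fin.exists_castSucc_eq.2 hi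
    exact htheta.le j
  obtain ⟨u, hu⟩ := balanced_iff_exists_isPotential.1 (hsw.symm.balanced hH hbal)
  exact hshape.exists_isHalfPreflow ht (fun i hi => hu.mono (hK i hi))
    (fun hR => hunb (hsw.balanced le_rfl hR)) hS (hZ e (hshape.isDistinguishedEdge ht))

/-! ### The algorithm -/

/-- The edges on which a preflow for the list `L` may vanish. -/
def zeroSet (L : List (Graph α β × CycleType)) : Set β :=
  {e | ∃ C, ((C, CycleType.negativeSpecial) ∈ L ∧ e ∈ E(C)) ∨
    ((C, CycleType.positive) ∈ L ∧ e ∈ E(C)) ∨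
    ((C, CycleType.fish) ∈ L ∧ IsDistinguishedEdge C e)}

/-- What the extension of a preflow over the members of `L` requires of the set `S` of subdivided
edges. Subdividing once each edge of `S` on a cycle `C` makes the length of `C` odd if and only if
`E(C) \ S` has odd size. -/
structure IsCompatible (t : β → Bool → α) (S : Set β) (L : List (Graph α β × CycleType)) :
    Prop where
  mem_edgeSet : ∀ p ∈ L, ∀ e ∈ S, ∀ b, t e b ∈ V(p.1) → e ∈ E(p.1)
  notMem : ∀ C, (C, CycleType.positive) ∈ L ∨ (C, CycleType.fish) ∈ L → ∀ e ∈ E(C), e ∉ S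
  odd : ∀ C, (C, CycleType.negativeOrdinary) ∈ L → Odd (E(C) \ S).ncard

section Algorithm

variable {σ : β → ℤˣ} {S Z : Set β} {t : β → Bool → α} {G R H C : Graph α β} {k : ℕ}
  {ty : CycleType} {L : List (Graph α β × CycleType)} {c : β × Bool → ZMod 3}

lemma eq_of_mem_of_mem (ht : IsEndLabelling G t) (hle : ∀ p ∈ L, p.1 ≤ G)
    (hd : L.Pairwise fun p q => Disjoint V(p.1) V(q.1)) {p q : Graph α β × CycleType}
    (hp : p ∈ L) (hq : q ∈ L) {e : β} {b : Bool} (he : e ∈ E(q.1)) (hb : t e b ∈ V(p.1)) :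
    p = q := by
  by_contra hne
  exact (List.Pairwise.forall (R := fun p q : Graph α β × CycleType => Disjoint V(p.1) V(q.1))
    hd hp hq hne).notMem_of_mem_left hb ((ht.mono (hle q hq)).mem he b)

lemma IsSubdivisionChoice.exists_mem (hS : IsSubdivisionChoice L S) {e : β} (he : e ∈ S) :
    ∃ q ∈ L, e ∈ E(q.1) ∧
      (q.2 = .negativeSpecial ∨ q.2 = .negativeOrdinary ∧ Even (length q.1)) := by
  obtain ⟨C, hC | ⟨hC, heven⟩, heC⟩ := hS.2 e he
  exacts [⟨_, hC, heC, .inl rfl⟩, ⟨_, hC, heC, .inr ⟨rfl, heven⟩⟩]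

lemma IsSubdivisionChoice.type_eq_or (ht : IsEndLabelling G t) (hle : ∀ p ∈ L, p.1 ≤ G)
    (hd : L.Pairwise fun p q => Disjoint V(p.1) V(q.1)) (hS : IsSubdivisionChoice L S)
    (hC : (C, ty) ∈ L) {e : β} (heC : e ∈ E(C)) (heS : e ∈ S) :
    ty = .negativeSpecial ∨ ty = .negativeOrdinary ∧ Even (length C) := by
  obtain ⟨q, hq, heq, hty⟩ := hS.exists_mem heS
  obtain rfl := eq_of_mem_of_mem ht hle hd hC hq heq ((ht.mono (hle _ hC)).mem heC false)
  exact hty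

lemma IsSubdivisionChoice.odd_ncard_sdiff [Finite β] (ht : IsEndLabelling G t)
    (hle : ∀ p ∈ L, p.1 ≤ G) (hd : L.Pairwise fun p q => Disjoint V(p.1) V(q.1))
    (hS : IsSubdivisionChoice L S) (hC : (C, CycleType.negativeOrdinary) ∈ L) :
    Odd (E(C) \ S).ncard := by
  have hinter := Set.ncard_inter_add_ncard_sdiff_eq_ncard E(C) S
  rcases Nat.even_or_odd (length C) with heven | hodd
  · obtain ⟨e, ⟨heS, heC⟩, huniq⟩ := hS.1 C (.inr ⟨hC, heven⟩)
    have hsingle : E(C) ∩ S = {e} :=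
      Set.eq_singleton_iff_unique_mem.2 ⟨⟨heC, heS⟩, fun e' he' => huniq e' he'.symm⟩
    rw [hsingle, Set.ncard_singleton] at hinter
    rwa [length, ← hinter, add_comm, Nat.even_add_one, Nat.not_even_iff_odd] at heven
  · have hdisj : Disjoint E(C) S := Set.disjoint_left.2 fun e heC heS =>
      Nat.not_even_iff_odd.2 hodd ((hS.type_eq_or ht hle hd hC heC heS).resolve_left nofun).2
    rwa [hdisj.sdiff_eq_left]

lemma IsSubdivisionChoice.isCompatible [Finite β] (ht : IsEndLabelling G t)
    (hle : ∀ p ∈ L, p.1 ≤ G) (hd : L.Pairwise fun p q => Disjoint V(p.1) V(q.1))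
    (hS : IsSubdivisionChoice L S) : IsCompatible t S L where
  mem_edgeSet p hp e he b hb := by
    obtain ⟨q, hq, heq, -⟩ := hS.exists_mem he
    rwa [eq_of_mem_of_mem ht hle hd hp hq heq hb]
  notMem C hC e heC heS := by
    rcases hC with hC | hC <;> simpa using hS.type_eq_or ht hle hd hC heC heS
  odd _ hC := hS.odd_ncard_sdiff ht hle hd hC

lemma IsChosenLeafBlock.le (h : IsChosenLeafBlock σ R H) : H ≤ R := h.1.1.1.1

lemma FinalStep.le (h : FinalStep σ R k C ty) : C ≤ R := by
  cases h with
  | fishOdd => exact le_rfl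
  | fishEven _ _ _ hC => exact hC.1
  | special _ _ _ hp _ => exact hp.1.1
  | positive _ _ _ hp _ => exact hp.2.1.2.1

lemma IsUsableIn.le (h : IsUsableIn σ R H C) : C ≤ H := h.elim And.left And.left

lemma Round.le (h : Round σ R k C ty) : C ≤ R := by
  cases h with
  | usableNegative H _ hH _ hC _ => exact hC.le.trans hH.le
  | usablePositive H _ hH _ hC _ => exact hC.le.trans hH.le
  | negativeBlock _ hH => exact hH.le
  | good H _ hH _ _ hC => exact hC.1.1.trans hH.le
  | final H D _ _ hH _ _ _ _ hF => exact hF.le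

lemma IsUsableIn.ncard_degree_ne_two_le (h : IsUsableIn σ R H C) (hn : IsNegativeCycle σ C) :
    {v ∈ V(C) | degree H v ≠ 2}.ncard ≤ 1 := by
  rcases h with ⟨-, ⟨v, rfl, -⟩ | ⟨hp, -⟩⟩ | ⟨-, -, h⟩
  · have hd := hn.1.2 v rfl
    simp [degree, Graph.incidenceSet, Graph.loopSet, Graph.Inc] at hd
  · exact absurd (hp.2.symm.trans hn.2) (by decide)
  · exact h

lemma IsUsableIn.isGoodIn (h : IsUsableIn σ R H C) (hn : ¬ IsNegativeCycle σ C) :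
    IsGoodIn σ R H C :=
  h.resolve_right fun h => hn h.2.1

lemma subset_zeroSet_of_positive (hC : (C, CycleType.positive) ∈ L) : E(C) ⊆ zeroSet L :=
  fun _ he => ⟨C, .inr (.inl ⟨hC, he⟩)⟩

lemma subset_zeroSet_of_negativeSpecial (hC : (C, CycleType.negativeSpecial) ∈ L) :
    E(C) ⊆ zeroSet L :=
  fun _ he => ⟨C, .inl ⟨hC, he⟩⟩

lemma IsCompatible.exists_off [Finite β] (hL : IsCompatible t S L) (ht : IsEndLabelling R t)
    (hCR : C ≤ R) (hdeg : ∀ v ∈ V(R), degree R v ≤ 3) (hmem : (C, ty) ∈ L)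
    (hc : IsHalfPreflow σ S Z t (R.deleteVerts V(C)) c) :
    ∃ c', IsHalfPreflowOff σ S Z t R C c' :=
  hc.exists_off ht hCR hdeg fun e he b hb heS => he.2 (hL.mem_edgeSet _ hmem e heS b hb)

section Extend

variable [Finite α] [Finite β]

lemma IsHalfPreflowOff.extend_isGood (ht : IsEndLabelling R t) (hC : IsGood σ R C)
    (hZ : E(C) ⊆ Z) (hS : ∀ e ∈ E(C), e ∉ S) (hc : IsHalfPreflowOff σ S Z t R C c) :
    ∃ f, IsHalfPreflow σ S Z t R f := by
  obtain ⟨hle, ⟨v, rfl, hd⟩ | ⟨hcyc, h2⟩⟩ := hC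
  exacts [hc.extend_noEdge ht hle hd, hc.extend_cycle_of_two_le_ncard ht hle hcyc.1 hZ hS h2]

lemma IsHalfPreflowOff.extend_isGoodIn (ht : IsEndLabelling R t) (hH : IsChosenLeafBlock σ R H)
    (hdeg : ∀ v ∈ V(R), degree R v ≤ 3) (hC : IsGoodIn σ R H C) (hZ : E(C) ⊆ Z)
    (hS : ∀ e ∈ E(C), e ∉ S) (hc : IsHalfPreflowOff σ S Z t R C c) :
    ∃ f, IsHalfPreflow σ S Z t R f := by
  obtain ⟨hle, ⟨v, rfl, hd⟩ | ⟨hcyc, h2⟩⟩ := hC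
  exacts [hc.extend_noEdge ht (hle.trans hH.le) hd,
    hc.extend_good_of_isLeafBlock ht hH.1 hdeg hle hcyc.1 h2 hZ hS]

lemma IsHalfPreflowOff.extend_negativeCycle_of_isLeafBlock (ht : IsEndLabelling R t)
    (hH : IsChosenLeafBlock σ R H) (hdeg : ∀ v ∈ V(R), degree R v ≤ 3) (hCH : C ≤ H)
    (hC : IsNegativeCycle σ C) (h : {v ∈ V(C) | degree H v ≠ 2}.ncard ≤ 1)
    (hodd : Odd (E(C) \ S).ncard) (hc : IsHalfPreflowOff σ S Z t R C c) :
    ∃ f, IsHalfPreflow σ S Z t R f :=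
  hc.extend_odd_negativeCycle ht (hCH.trans hH.le) hdeg hC hodd
    (hH.1.subsingleton_of_isCycle ht hdeg hCH hC.1 h)

lemma IsCompatible.extend_negativeSpecial (hL : IsCompatible t S L) (ht : IsEndLabelling R t)
    (hdeg : ∀ v ∈ V(R), degree R v ≤ 3) (hCR : C ≤ R) (hn : IsNegativeCycle σ C)
    (hmem : (C, CycleType.negativeSpecial) ∈ L)
    (hc : IsHalfPreflow σ S (zeroSet L) t (R.deleteVerts V(C)) c) :
    ∃ f, IsHalfPreflow σ S (zeroSet L) t R f := by
  obtain ⟨c, hc⟩ := hL.exists_off ht hCR hdeg hmem hc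
  exact hc.extend_negativeCycle ht hCR hn (subset_zeroSet_of_negativeSpecial hmem)

lemma FinalStep.exists_isHalfPreflow (h : FinalStep σ R k C ty) (ht : IsEndLabelling R t)
    (hL : IsCompatible t S L) (hmem : (C, ty) ∈ L)
    (hc : IsHalfPreflowOff σ S (zeroSet L) t R C c) :
    ∃ f, IsHalfPreflow σ S (zeroSet L) t R f := by
  cases h with
  | fishOdd hfish =>
    obtain ⟨τ, hsw, hfish⟩ := hfish
    exact exists_isHalfPreflow_of_isFish ht hsw hfish (hL.notMem _ (.inr hmem))
      fun e he => ⟨_, .inr (.inr ⟨hmem, he⟩)⟩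
  | fishEven _ _ _ hC =>
    exact hc.extend_isGood ht hC (subset_zeroSet_of_positive hmem) (hL.notMem _ (.inl hmem))
  | special _ _ _ hp _ =>
    exact hc.extend_negativeCycle ht hp.1.1 hp.1.2 (subset_zeroSet_of_negativeSpecial hmem)
  | positive _ _ _ hp _ =>
    exact hc.extend_isGood ht hp.2.1.2 (subset_zeroSet_of_positive hmem)
      (hL.notMem _ (.inl hmem))

lemma Round.exists_isHalfPreflow (h : Round σ R k C ty) (ht : IsEndLabelling R t)
    (hdeg : ∀ v ∈ V(R), degree R v ≤ 3) (hL : IsCompatible t S L) (hmem : (C, ty) ∈ L)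
    (hc : IsHalfPreflow σ S (zeroSet L) t (R.deleteVerts V(C)) c) :
    ∃ f, IsHalfPreflow σ S (zeroSet L) t R f := by
  obtain ⟨c, hc⟩ := hL.exists_off ht h.le hdeg hmem hc
  cases h with
  | usableNegative H _ hH _ hC hn =>
    exact hc.extend_negativeCycle_of_isLeafBlock ht hH hdeg hC.le hn (hC.ncard_degree_ne_two_le hn)
      (hL.odd _ hmem)
  | usablePositive H _ hH _ hC hn =>
    exact hc.extend_isGoodIn ht hH hdeg (hC.isGoodIn hn) (subset_zeroSet_of_positive hmem)
      (hL.notMem _ (.inl hmem))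
  | negativeBlock _ hH _ hn =>
    have hempty : {v ∈ V(C) | degree C v ≠ 2} = ∅ :=
      Set.eq_empty_of_forall_notMem fun v hv => hv.2 (hn.1.2 v hv.1)
    exact hc.extend_negativeCycle_of_isLeafBlock ht hH hdeg le_rfl hn (by simp [hempty])
      (hL.odd _ hmem)
  | good H _ hH _ _ hC =>
    exact hc.extend_isGoodIn ht hH hdeg hC.1 (subset_zeroSet_of_positive hmem)
      (hL.notMem _ (.inl hmem))
  | final H D _ _ hH _ _ _ _ hF => exact hF.exists_isHalfPreflow ht hL hmem hc

end Extend

lemma deleteVerts_deleteVerts (G : Graph α β) (X Y : Set α) :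
    (G.deleteVerts X).deleteVerts Y = G.deleteVerts (X ∪ Y) := by
  refine Graph.ext ?_ fun e x y => ?_
  · simp only [Graph.vertexSet_deleteVerts, Set.sdiff_sdiff]
  · simp only [Graph.deleteVerts_isLink, Set.mem_union]
    tauto

lemma remaining_append_singleton (G : Graph α β) (L : List (Graph α β × CycleType))
    (C : Graph α β) (ty : CycleType) :
    remaining G (L ++ [(C, ty)]) = (remaining G L).deleteVerts V(C) := by
  rw [remaining, remaining, deleteVerts_deleteVerts]
  congr 1
  ext v
  simp [or_and_right, exists_or]

lemma remaining_singleton (G C : Graph α β) (ty : CycleType) :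
    remaining G [(C, ty)] = G.deleteVerts V(C) := by
  simp [remaining]

lemma remaining_le (G : Graph α β) (L : List (Graph α β × CycleType)) : remaining G L ≤ G :=
  Graph.deleteVerts_le

lemma Partial.le (h : Partial σ G L) : ∀ p ∈ L, p.1 ≤ G := by
  induction h with
  | start C _ hC => simpa using hC
  | step L C ty _ hr ih =>
    refine List.forall_mem_append.2 ⟨ih, ?_⟩
    simpa using hr.le.trans (remaining_le G L)

lemma Partial.pairwise_disjoint (h : Partial σ G L) :
    L.Pairwise fun p q => Disjoint V(p.1) V(q.1) := by
  induction h with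
  | start => exact List.pairwise_singleton _ _
  | step L C ty _ hr ih =>
    refine List.pairwise_append.2 ⟨ih, List.pairwise_singleton _ _, fun p hp q hq => ?_⟩
    obtain rfl := List.mem_singleton.1 hq
    exact Set.disjoint_right.2 fun v hv hvp => (hr.le.vertexSet_mono hv).2 ⟨p, hp, hvp⟩

lemma degree_le_of_le [Finite β] (ht : IsEndLabelling G t) (hle : R ≤ G) {d : ℕ}
    (hdeg : ∀ v ∈ V(G), degree G v ≤ d) : ∀ v ∈ V(R), degree R v ≤ d :=
  fun v hv => (degree_mono ht hle v).trans (hdeg v (hle.vertexSet_mono hv))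

lemma Partial.exists_isHalfPreflow [Finite α] [Finite β] (ht : IsEndLabelling G t)
    (hdeg : ∀ v ∈ V(G), degree G v ≤ 3) (hL : IsCompatible t S L)
    {L' : List (Graph α β × CycleType)} (h : Partial σ G L') (hsub : L' ⊆ L)
    (hex : ∃ c, IsHalfPreflow σ S (zeroSet L) t (remaining G L') c) :
    ∃ f, IsHalfPreflow σ S (zeroSet L) t G f := by
  obtain ⟨c, hc⟩ := hex
  induction h generalizing c with
  | start C _ hle hn _ =>
    rw [remaining_singleton] at hc
    exact hL.extend_negativeSpecial ht hdeg hle hn (hsub (by simp)) hc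
  | step L' C ty _ hr ih =>
    rw [remaining_append_singleton] at hc
    have hle := remaining_le G L'
    obtain ⟨c, hc⟩ := hr.exists_isHalfPreflow (ht.mono hle) (degree_le_of_le ht hle hdeg) hL
      (hsub (by simp)) hc
    exact ih (fun p hp => hsub (by simp [hp])) c hc

lemma Returned.exists_isHalfPreflow [Finite α] [Finite β] (ht : IsEndLabelling G t)
    (hdeg : ∀ v ∈ V(G), degree G v ≤ 3) (h : Returned σ G L) (hS : IsSubdivisionChoice L S) :
    ∃ f, IsHalfPreflow σ S (zeroSet L) t G f := by
  cases h with
  | preprocess C₁ C₂ hp =>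
    obtain ⟨hle₁, hle₂, hn₁, hn₂, hd, hcover⟩ := hp
    have hL := hS.isCompatible ht (by simp [hle₁, hle₂]) (by simp [hd])
    have hle : G.deleteVerts V(C₁) ≤ G := Graph.deleteVerts_le
    have hempty : V((G.deleteVerts V(C₁)).deleteVerts V(C₂)) = ∅ := by
      rw [Graph.vertexSet_deleteVerts, Graph.vertexSet_deleteVerts, Set.sdiff_sdiff, hcover,
        Set.sdiff_self]
    obtain ⟨c, hc⟩ := hL.extend_negativeSpecial (ht.mono hle) (degree_le_of_le ht hle hdeg)
      (le_deleteVerts hle₂ hd.symm) hn₂ (by simp)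
      (isHalfPreflow_of_vertexSet_eq_empty hempty fun _ => 0)
    exact hL.extend_negativeSpecial ht hdeg hle₁ hn₁ (by simp) hc
  | recursion _ hp hempty =>
    exact hp.exists_isHalfPreflow ht hdeg (hS.isCompatible ht hp.le hp.pairwise_disjoint)
      (List.Subset.refl L) ⟨fun _ => 0, isHalfPreflow_of_vertexSet_eq_empty hempty _⟩

end Algorithm

/-! ### Subdivision -/

section Orientation

variable {K : Graph α β} {σ : β → ℤˣ} {Z : Set β} {t : β → Bool → α} {c : β × Bool → ZMod 3}

lemma halfEdgeSum_comp_xor {A : Type*} [AddCommMonoid A] {t' : β → Bool → α}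
    {r : β → Bool} (h : ∀ e ∈ E(K), ∀ b, t' e (b ^^ r e) = t e b) (f : β × Bool → A) (v : α) :
    halfEdgeSum t E(K) (fun p => f (p.1, p.2 ^^ r p.1)) v = halfEdgeSum t' E(K) f v := by
  have hinv : Function.Involutive fun p : β × Bool => (p.1, p.2 ^^ r p.1) := fun p => by simp
  have himage : (fun p : β × Bool => (p.1, p.2 ^^ r p.1)) '' halfEdgesAt t E(K) v =
      halfEdgesAt t' E(K) v := by
    ext ⟨e, b⟩
    rw [hinv.image_eq_preimage_symm]
    refine and_congr_right fun he => ?_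
    rw [← h e he]
    simp
  rw [halfEdgeSum, halfEdgeSum, ← himage, finsum_mem_image hinv.injective.injOn]

lemma zsmul_eq_sg_mul (u : ℤˣ) (a : ZMod 3) : (u : ℤ) • a = sg u * a := zsmul_eq_mul a _

lemma Orientation.exists_boundary_eq (O : Orientation K σ) (ht : IsEndLabelling K t)
    (hc : ∀ e ∈ E(K), edgeDefect σ c e = 0) :
    ∃ φ : β → ZMod 3, (∀ e, φ e = 0 → c (e, false) = 0) ∧
      ∀ v, boundary O φ v = halfEdgeSum t E(K) c v := by
  have htip : IsEndLabelling K O.tip := O.isLink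
  have hr : ∀ e, ∃ r : Bool, e ∈ E(K) → ∀ b, O.tip e (b ^^ r) = t e b := fun e => by
    by_cases he : e ∈ E(K)
    · obtain ⟨r, h₀, h₁⟩ := htip.exists_of_isLink (ht e he)
      exact ⟨r, fun _ => Bool.forall_bool.2 ⟨by simpa using h₀, by simpa using h₁⟩⟩
    · exact ⟨false, fun h => (he h).elim⟩
  choose r hr using hr
  refine ⟨fun e => sg (O.dir e (r e)) * c (e, false),
    fun e he => (mul_eq_zero.1 he).resolve_left (sg_ne_zero _), fun v => ?_⟩
  refine (halfEdgeSum_comp_xor hr _ v).symm.trans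
    (halfEdgeSum_congr fun ⟨e, b⟩ he => ?_)
  have hdir : O.dir e (!r e) * O.dir e (r e) = -σ e := by
    rw [← O.dir_mul_dir e he.1]
    cases r e
    exacts [mul_comm _ _, rfl]
  rw [zsmul_eq_sg_mul, ← mul_assoc, ← map_mul]
  cases b
  · simp
  · have hdefect := hc e he.1
    rw [edgeDefect] at hdefect
    rw [Bool.true_xor, hdir, sg_neg]
    linear_combination -hdefect

lemma IsHalfPreflow.exists_isPreflow (hc : IsHalfPreflow σ ∅ Z t K c)
    (ht : IsEndLabelling K t) (O : Orientation K σ) :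
    ∃ φ : β → ZMod 3, IsPreflow O φ ∧ ∀ e ∈ E(K), φ e = 0 → e ∈ Z := by
  obtain ⟨φ, hφ, hboundary⟩ := O.exists_boundary_eq ht fun e he =>
    not_not.1 ((hc.edgeDefect_ne_zero_iff e he).not.2 (Set.notMem_empty e))
  refine ⟨φ, fun v hv => ?_, fun e he h => hc.mem_of_eq_zero e he false (hφ e h)⟩
  rw [hboundary v]
  exact hc.fitsDegree v hv

end Orientation

section Subdivide

variable {G : Graph α β} {ℓ : EndLabelling G} {S Z : Set β} {σ : β → ℤˣ} {e : β} {b : Bool}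

/-- The end labelling of a subdivision in which `false` is the original end of every half of a
subdivided edge. -/
def subdivideTip (ℓ : EndLabelling G) : β ⊕ β × Bool → Bool → α ⊕ β
  | .inl e, b => .inl (ℓ.tip e b)
  | .inr p, false => .inl (ℓ.tip p.1 p.2)
  | .inr p, true => .inr p.1

lemma inl_mem_edgeSet_subdivide : Sum.inl e ∈ E(subdivide G ℓ S) ↔ e ∈ E(G) ∧ e ∉ S := by
  constructor
  · rintro ⟨u, v, h, x, y, hl, -, -⟩
    exact ⟨hl.edge_mem, h⟩
  · rintro ⟨he, h⟩
    exact ⟨_, _, h, _, _, ℓ.isLink e he, rfl, rfl⟩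

lemma inr_mem_edgeSet_subdivide : Sum.inr (e, b) ∈ E(subdivide G ℓ S) ↔ e ∈ E(G) ∧ e ∈ S := by
  constructor
  · rintro ⟨u, v, h, h', -⟩
    exact ⟨h', h⟩
  · rintro ⟨he, h⟩
    exact ⟨_, _, h, he, .inl ⟨rfl, rfl⟩⟩

lemma isEndLabelling_subdivideTip : IsEndLabelling (subdivide G ℓ S) (subdivideTip ℓ) := by
  rintro (e | ⟨e, b⟩) he
  · obtain ⟨he, hS⟩ := inl_mem_edgeSet_subdivide.1 he
    exact ⟨hS, _, _, ℓ.isLink e he, rfl, rfl⟩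
  · obtain ⟨he, hS⟩ := inr_mem_edgeSet_subdivide.1 he
    exact ⟨hS, he, .inl ⟨rfl, rfl⟩⟩

open Classical in
/-- The half-edge of a subdivision that a half-edge of the original graph becomes. -/
noncomputable def subdivideHalfEdge (S : Set β) (h : β × Bool) : (β ⊕ β × Bool) × Bool :=
  if h.1 ∈ S then (.inr h, false) else (.inl h.1, h.2)

lemma subdivideHalfEdge_injective (S : Set β) : Function.Injective (subdivideHalfEdge S) := by
  rintro ⟨e, b⟩ ⟨e', b'⟩ h
  unfold subdivideHalfEdge at h
  split_ifs at h <;> cases h <;> rfl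

lemma halfEdgesAt_subdivide_inl (v : α) :
    halfEdgesAt (subdivideTip ℓ) E(subdivide G ℓ S) (.inl v) =
      subdivideHalfEdge S '' halfEdgesAt ℓ.tip E(G) v := by
  apply subset_antisymm
  · rintro ⟨e | ⟨e, b⟩, b'⟩ ⟨hmem, hv⟩
    · obtain ⟨he, hS⟩ := inl_mem_edgeSet_subdivide.1 hmem
      exact ⟨(e, b'), ⟨he, Sum.inl_injective hv⟩, if_neg hS⟩
    · obtain ⟨he, hS⟩ := inr_mem_edgeSet_subdivide.1 hmem
      cases b' with
      | false => exact ⟨(e, b), ⟨he, Sum.inl_injective hv⟩, if_pos hS⟩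
      | true => exact nomatch hv
  · rintro _ ⟨⟨e, b⟩, ⟨he, rfl⟩, rfl⟩
    unfold subdivideHalfEdge
    split_ifs with hS
    · exact ⟨inr_mem_edgeSet_subdivide.2 ⟨he, hS⟩, rfl⟩
    · exact ⟨inl_mem_edgeSet_subdivide.2 ⟨he, hS⟩, rfl⟩

lemma halfEdgesAt_subdivide_inr (he : e ∈ E(G)) (hS : e ∈ S) :
    halfEdgesAt (subdivideTip ℓ) E(subdivide G ℓ S) (.inr e) =
      {(.inr (e, false), true), (.inr (e, true), true)} := by
  ext ⟨e' | ⟨e', b⟩, b'⟩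
  · simp [halfEdgesAt, subdivideTip]
  · cases b' with
    | false => simp [halfEdgesAt, subdivideTip]
    | true =>
      constructor
      · rintro ⟨-, h⟩
        obtain rfl := Sum.inr_injective h
        cases b <;> simp
      · rintro (h | h) <;> cases h <;> exact ⟨inr_mem_edgeSet_subdivide.2 ⟨he, hS⟩, rfl⟩

/-- The values on the half-edges of a subdivision that arise from the values `c` on the half-edges
of the original graph if no edge of the subdivision has a defect. -/
def subdivideValue (σ' : β ⊕ β × Bool → ℤˣ) (c : β × Bool → ZMod 3) :
    (β ⊕ β × Bool) × Bool → ZMod 3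
  | (.inl e, b) => c (e, b)
  | (.inr p, false) => c p
  | (.inr p, true) => -(sg (σ' (.inr p)) * c p)

variable {σ' : β ⊕ β × Bool → ℤˣ} {c : β × Bool → ZMod 3}

lemma halfEdgeSum_subdivide_inl (v : α) :
    halfEdgeSum (subdivideTip ℓ) E(subdivide G ℓ S) (subdivideValue σ' c) (.inl v) =
      halfEdgeSum ℓ.tip E(G) c v := by
  rw [halfEdgeSum, halfEdgesAt_subdivide_inl,
    finsum_mem_image (subdivideHalfEdge_injective S).injOn]
  refine finsum_mem_congr rfl fun h _ => ?_
  unfold subdivideHalfEdge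
  split_ifs <;> rfl

lemma halfEdgeSum_subdivide_inr_ne_zero (hσ' : IsSubdividedSignature G S σ σ')
    (he : e ∈ E(G)) (hS : e ∈ S) (hc : edgeDefect σ c e ≠ 0) :
    halfEdgeSum (subdivideTip ℓ) E(subdivide G ℓ S) (subdivideValue σ' c) (.inr e) ≠ 0 := by
  rw [halfEdgeSum, halfEdgesAt_subdivide_inr he hS, finsum_mem_pair (by simp)]
  simp only [subdivideValue]
  contrapose! hc
  rw [edgeDefect, ← (hσ' e he).2 hS, map_mul]
  linear_combination -sg (σ' (.inr (e, true))) * hc -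
    c (e, true) * sg_mul_self (σ' (.inr (e, true)))

lemma IsHalfPreflow.subdivide [Finite β] (hc : IsHalfPreflow σ S Z ℓ.tip G c)
    (hσ' : IsSubdividedSignature G S σ σ') :
    IsHalfPreflow σ' ∅ (parent ⁻¹' Z) (subdivideTip ℓ) (subdivide G ℓ S)
      (subdivideValue σ' c) where
  edgeDefect_ne_zero_iff := by
    rintro (e | ⟨e, b⟩) he
    · obtain ⟨he, hS⟩ := inl_mem_edgeSet_subdivide.1 he
      simpa [edgeDefect, subdivideValue, (hσ' e he).1 hS, hS] using hc.edgeDefect_ne_zero_iff e he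
    · simp [edgeDefect, subdivideValue]
  mem_of_eq_zero := by
    rintro (e | ⟨e, b⟩) he b' h
    · exact hc.mem_of_eq_zero e (inl_mem_edgeSet_subdivide.1 he).1 b' h
    · refine hc.mem_of_eq_zero e (inr_mem_edgeSet_subdivide.1 he).1 b ?_
      cases b'
      · exact h
      · simpa [subdivideValue, sg_ne_zero] using h
  fitsDegree := by
    rintro _ (⟨v, hv, rfl⟩ | ⟨e, ⟨hS, he⟩, rfl⟩)
    · rw [degree_eq_ncard_halfEdgesAt isEndLabelling_subdivideTip, halfEdgesAt_subdivide_inl,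
        Set.ncard_image_of_injective _ (subdivideHalfEdge_injective S),
        ← degree_eq_ncard_halfEdgesAt ℓ.isLink, halfEdgeSum_subdivide_inl]
      exact hc.fitsDegree v hv
    · rw [degree_eq_ncard_halfEdgesAt isEndLabelling_subdivideTip, halfEdgesAt_subdivide_inr he hS,
        Set.ncard_pair (by simp)]
      simpa [FitsDegree] using halfEdgeSum_subdivide_inr_ne_zero hσ' he hS
        ((hc.edgeDefect_ne_zero_iff e he).2 hS)

end Subdivide

theorem lemma5p3_general [Finite α] [Finite β] (G : Graph α β) (σ : β → ℤˣ)
    (hdeg : ∀ v ∈ V(G), degree G v ≤ 3)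
    (L : List (Graph α β × CycleType)) (hL : Returned σ G L)
    (S : Set β) (hS : IsSubdivisionChoice L S)
    (ℓ : EndLabelling G) (σ' : β ⊕ β × Bool → ℤˣ) (hσ' : IsSubdividedSignature G S σ σ')
    (O : Orientation (subdivide G ℓ S) σ') :
    ∃ φ : β ⊕ β × Bool → ZMod 3, IsPreflow O φ ∧
      ∀ e ∈ E(subdivide G ℓ S), φ e = 0 →
        ∃ C, ((C, CycleType.negativeSpecial) ∈ L ∧ parent e ∈ E(C)) ∨
          ((C, CycleType.positive) ∈ L ∧ parent e ∈ E(C)) ∨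
          ((C, CycleType.fish) ∈ L ∧ IsDistinguishedEdge C (parent e)) := by
  obtain ⟨c, hc⟩ := hL.exists_isHalfPreflow ℓ.isLink hdeg hS
  exact (hc.subdivide hσ').exists_isPreflow isEndLabelling_subdivideTip O

end CycleSelection

open CycleSelection in
theorem lemma5p3 {α β : Type*} [Finite α] [Finite β] (G : Graph α β) (σ : β → ℤˣ)
    (hcubic : Cubic G) (hconn : EdgeConnected 3 G)
    (hneg : ∃ D₁ ≤ G, ∃ D₂ ≤ G, IsNegativeCycle σ D₁ ∧ IsNegativeCycle σ D₂ ∧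
      Disjoint V(D₁) V(D₂))
    (L : List (Graph α β × CycleType)) (hL : Returned σ G L)
    (S : Set β) (hS : IsSubdivisionChoice L S)
    (ℓ : EndLabelling G) (σ' : β ⊕ β × Bool → ℤˣ) (hσ' : IsSubdividedSignature G S σ σ')
    (O : Orientation (subdivide G ℓ S) σ') :
    ∃ φ : β ⊕ β × Bool → ZMod 3, IsPreflow O φ ∧
      ∀ e ∈ E(subdivide G ℓ S), φ e = 0 →
        ∃ C, ((C, CycleType.negativeSpecial) ∈ L ∧ parent e ∈ E(C)) ∨
          ((C, CycleType.positive) ∈ L ∧ parent e ∈ E(C)) ∨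
          ((C, CycleType.fish) ∈ L ∧ IsDistinguishedEdge C (parent e)) :=
  lemma5p3_general G σ (fun v hv => (hcubic v hv).le) L hL S hS ℓ σ' hσ' O
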